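/- Let $\kappa$ be a field of characteristic $0$. **Free models.** Let $(\Lambda[V],d)$ be a free connected CDGA over $\kappa$: $V=\bigoplus_{n\ge 1}V^n$ is a graded vector space, $\Lambda[V]$ is the free commutative graded algebra on $V$, and $d$ is an exterior differential of degree $+1$. Put $\overline V^{\,n}=V^{n+1}$. The free loop construction is the mixed CDGA $(\Lambda[V\oplus\overline V],\delta,i)$, where $i$ is the derivation of degree $-1$ with $i(v)=\overline v$, $i(\overline v)=0$, and $\delta$ is the derivation of degree $+1$ with $\delta(v)=d(v)$, $\delta(\overline v)=-i(d(v))$. **The complexes.** For a mixed complex $(C^n,\delta,\beta)_{n\ge0}$ ($\delta$ of degree $+1$, $\beta$ of degree $-1$, $\delta^2=\beta^2=\delta\beta+\beta\delta=0$) and $r\in\mathbb Z$ let ${}^+C^r=\prod_{k\ge 0}C^{r-2k}$ and $\mathbb PC^r=\prod_{n\ge 0,\ n\equiv r \,(2)}C^n$, both with differential $\delta+\beta$ (in ${}^+C$ and $\mathbb PC$ alike, $C^n=0$ for $n<0$). Define $$CH^r(\Lambda[V],d)=H^r\big({}^+C(\Lambda[V\oplus\overline V],\delta,i)\big),\qquad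 K^r(\Lambda[V],d)=\prod_{n\ge0,\ n\equiv r\,(2)}H^n(\Lambda[V],d)=H^r\big(\mathbb PC(\Lambda[V],d,0)\big).$$ Let $\underline I:{}^+C^{*-2}(\Lambda[V\oplus\overline V],\delta,i)\hookrightarrow\mathbb PC^{*}(\Lambda[V\oplus\overline V],\delta,i)\to\mathbb PC^{*}(\Lambda[V],d,0)$ be the inclusion followed by the map induced by the projection on the part of weight zero, $v\mapsto v$, $\overline v\mapsto 0$. Its mapping cone is $\mathbb PC^r(\Lambda[V],d,0)\oplus{}^+C^{r-1}(\Lambda[V\oplus\overline V],\delta,i)$ in degree $r$, with differential $(x,y)\mapsto(Dx+\underline I y,-Dy)$, where $D$ denotes the differentials of the two complexes, and $$SH^r(\Lambda[V],d)=H^r(\mathrm{Cone}(\underline I)).$$ The inclusion and the projection of the cone induce $\mathbb J^r:K^r\to SH^r$ and $\mathbb B^r:SH^r\to CH^{r-1}$. The unit $\kappa=\Lambda[0]\to\Lambda[V]$ defines the reduced groups $$\overline K^r=\mathrm{coker}\big(K^r(\kappa)\to K^r(\Lambda[V],d)\big),\qquad \overline{CH}^r=\mathrm{coker}\big(CH^r(\kappa)\to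 CH^r(\Lambda[V],d)\big).$$ **Theorem.** Let $(\mathcal A,d_{\mathcal A})$ be a homologically $1$-connected CDGA over $\kappa$ (that is, $H^0(\mathcal A)=\kappa$ and $H^1(\mathcal A)=0$), and let $\theta:(\Lambda[V],d)\to(\mathcal A,d_{\mathcal A})$ be a quasi-isomorphism from a free connected CDGA (for instance a minimal model of $\mathcal A$, or the identity if $\mathcal A$ is itself free connected); the groups $K^r$, $SH^r$, $CH^r$ of $\mathcal A$ are those of $(\Lambda[V],d)$. Then, for every $r\ge 1$, the map $\mathbb J^r$ factors through $\overline K^r$, and with the composition $SH^r\xrightarrow{\mathbb B^r}CH^{r-1}\to\overline{CH}^{r-1}$ it gives a short exact sequence $$0\to\overline K^r\xrightarrow{\ \mathbb J^r\ }SH^r\xrightarrow{\ \mathbb B^r\ }\overline{CH}^{r-1}\to 0 .$$ -/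

import Mathlib

open scoped DirectSum

namespace CyclicCDGA

universe u v w x

/-! ## Cochain complexes and mapping cones -/

/-- A cochain complex of vector spaces indexed by `ℤ`, whose term of degree `r` is realised as a
subspace `deg r` of one ambient vector space `T`, the differential being the restriction of an
endomorphism `D` of `T`. (The subspaces `deg r` need not be independent: for a 2-periodic complex
`deg r = deg (r + 2)`.) -/
structure CochainCx (κ : Type u) [Field κ] where
  T : Type v
  [grp : AddCommGroup T]
  [mod : Module κ T]
  D : T →ₗ[κ] T
  deg : ℤ → Submodule κ T
  D_mem : ∀ r : ℤ, ∀ x ∈ deg r, D x ∈ deg (r + 1)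
  D_D : ∀ x : T, D (D x) = 0

attribute [instance] CochainCx.grp CochainCx.mod

namespace CochainCx

variable {κ : Type u} [Field κ]

/-- Cocycles of degree `r`. -/
def Z (C : CochainCx.{u, v} κ) (r : ℤ) : Submodule κ C.T := C.deg r ⊓ LinearMap.ker C.D

/-- Coboundaries of degree `r`: the image of the term of degree `r - 1`. -/
def B (C : CochainCx.{u, v} κ) (r : ℤ) : Submodule κ C.T := (C.deg (r - 1)).map C.D

/-- The cohomology `H^r(C) = Z^r / B^r`. -/
abbrev H (C : CochainCx.{u, v} κ) (r : ℤ) : Type v := C.Z r ⧸ (C.B r).submoduleOf (C.Z r)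

/-- The linear map in cohomology induced by a linear map that preserves cocycles and
coboundaries. -/
def cohMap {C : CochainCx.{u, v} κ} {C' : CochainCx.{u, w} κ} {r r' : ℤ} (f : C.T →ₗ[κ] C'.T)
    (hZ : ∀ x ∈ C.Z r, f x ∈ C'.Z r') (hB : ∀ x ∈ C.B r, f x ∈ C'.B r') :
    C.H r →ₗ[κ] C'.H r' :=
  Submodule.mapQ _ _ (f.restrict hZ) (fun x hx => hB x.1 hx)

/-- A morphism of cochain complexes (of degree zero). -/
structure Hom (C : CochainCx.{u, v} κ) (C' : CochainCx.{u, w} κ) where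
  f : C.T →ₗ[κ] C'.T
  f_mem : ∀ r : ℤ, ∀ x ∈ C.deg r, f x ∈ C'.deg r
  comm : ∀ x : C.T, f (C.D x) = C'.D (f x)

/-- The map `H^r(f)` induced by a morphism of cochain complexes. -/
def Hom.map {C : CochainCx.{u, v} κ} {C' : CochainCx.{u, w} κ} (f : Hom C C') (r : ℤ) :
    C.H r →ₗ[κ] C'.H r :=
  cohMap f.f
    (fun x hx => ⟨f.f_mem r x hx.1, by
      have h : C.D x = 0 := hx.2
      simp [← f.comm, h]⟩)
    (by
      rintro _ ⟨y, hy, rfl⟩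
      exact ⟨f.f y, f.f_mem _ y hy, (f.comm y).symm⟩)

/-- Composition of morphisms of cochain complexes. -/
def Hom.comp {C : CochainCx.{u, v} κ} {C' : CochainCx.{u, w} κ} {C'' : CochainCx.{u, x} κ}
    (g : Hom C' C'') (f : Hom C C') : Hom C C'' where
  f := g.f ∘ₗ f.f
  f_mem r y hy := g.f_mem r _ (f.f_mem r y hy)
  comm y := by simp [f.comm, g.comm]

/-- The complex `C^{*+s}`, with `C^{r+s}` in degree `r` and the same differential. -/
def reindex (C : CochainCx.{u, v} κ) (s : ℤ) : CochainCx.{u, v} κ where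
  T := C.T
  D := C.D
  deg r := C.deg (r + s)
  D_mem r x hx := by
    have := C.D_mem _ x hx
    rwa [show r + 1 + s = r + s + 1 by ring]
  D_D := C.D_D

/-- The mapping cone of `f : C₁ → C₂`: in degree `r` it is `C₂^r ⊕ C₁^{r+1}`, and
`d (x, y) = (d₂ x + f y, - d₁ y)`. -/
def cone {C₁ : CochainCx.{u, v} κ} {C₂ : CochainCx.{u, w} κ} (f : Hom C₁ C₂) :
    CochainCx.{u, max v w} κ where
  T := C₂.T × C₁.T
  D := (C₂.D.coprod f.f).prod (-(C₁.D ∘ₗ LinearMap.snd κ C₂.T C₁.T))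
  deg r := (C₂.deg r).prod (C₁.deg (r + 1))
  D_mem r x hx := ⟨add_mem (C₂.D_mem r _ hx.1) (f.f_mem _ _ hx.2),
    neg_mem (C₁.D_mem _ _ hx.2)⟩
  D_D x := by
    ext
    · simp [C₂.D_D, f.comm]
    · simp [C₁.D_D]

/-- The inclusion of `C₂` in the mapping cone of `f : C₁ → C₂`. -/
def coneInl {C₁ : CochainCx.{u, v} κ} {C₂ : CochainCx.{u, w} κ} (f : Hom C₁ C₂) :
    Hom C₂ (cone f) where
  f := LinearMap.inl κ C₂.T C₁.T
  f_mem r x hx := ⟨hx, (C₁.deg (r + 1)).zero_mem⟩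
  comm x := by
    change (C₂.D x, (0 : C₁.T)) = (C₂.D x + f.f 0, -(C₁.D 0))
    simp

end CochainCx

/-! ## Mixed complexes -/

/-- A mixed complex `(C^*, δ, β)`, graded by the non-negative integers; `β n` is the map
`C^{n+1} → C^n` (and `β` vanishes on `C^0`). -/
structure MixedComplex (κ : Type u) [Field κ] where
  C : ℕ → Type v
  [grp : ∀ n, AddCommGroup (C n)]
  [mod : ∀ n, Module κ (C n)]
  δ : ∀ n, C n →ₗ[κ] C (n + 1)
  β : ∀ n, C (n + 1) →ₗ[κ] C n
  δ_δ : ∀ n x, δ (n + 1) (δ n x) = 0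
  β_β : ∀ n x, β n (β (n + 1) x) = 0
  β_δ_zero : ∀ x, β 0 (δ 0 x) = 0
  β_δ : ∀ n x, β (n + 1) (δ (n + 1) x) + δ n (β n x) = 0

attribute [instance] MixedComplex.grp MixedComplex.mod

namespace MixedComplex

variable {κ : Type u} [Field κ]

/-- The coboundaries of `(C, δ)` in degree `n`. -/
def cob (M : MixedComplex.{u, v} κ) : ∀ n, Submodule κ (M.C n)
  | 0 => ⊥
  | n + 1 => LinearMap.range (M.δ n)

/-- `H^n(C, δ)`. -/
abbrev H (M : MixedComplex.{u, v} κ) (n : ℕ) : Type v :=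
  LinearMap.ker (M.δ n) ⧸ (M.cob n).submoduleOf (LinearMap.ker (M.δ n))

/-- The total differential `δ + β` on sequences `(ω₀, ω₁, ω₂, …)`, `ω_n ∈ C^n`, as a function. -/
def totFun (M : MixedComplex.{u, v} κ) (ω : ∀ n, M.C n) : ∀ n, M.C n
  | 0 => M.β 0 (ω 1)
  | n + 1 => M.δ n (ω n) + M.β (n + 1) (ω (n + 2))

/-- The total differential `δ + β` on `∏ₙ C^n`. -/
def totD (M : MixedComplex.{u, v} κ) : (∀ n, M.C n) →ₗ[κ] (∀ n, M.C n) where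
  toFun := M.totFun
  map_add' x y := by
    funext n
    cases n with
    | zero => simp [totFun]
    | succ n => simp [totFun]; abel
  map_smul' c x := by
    funext n
    cases n with
    | zero => simp [totFun]
    | succ n => simp [totFun]

theorem totD_totD (M : MixedComplex.{u, v} κ) (ω : ∀ n, M.C n) : M.totD (M.totD ω) = 0 := by
  funext n
  match n with
  | 0 =>
    change M.β 0 (M.δ 0 (ω 0) + M.β 1 (ω 2)) = 0
    simp [M.β_δ_zero, M.β_β]
  | 1 =>
    change M.δ 0 (M.β 0 (ω 1)) + M.β 1 (M.δ 1 (ω 1) + M.β 2 (ω 3)) = 0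
    have := M.β_δ 0 (ω 1)
    simp only [map_add, M.β_β, add_zero]
    exact (add_comm _ _).trans this
  | n + 2 =>
    change M.δ (n + 1) (M.δ n (ω n) + M.β (n + 1) (ω (n + 2))) +
      M.β (n + 2) (M.δ (n + 2) (ω (n + 2)) + M.β (n + 3) (ω (n + 4))) = 0
    have := M.β_δ (n + 1) (ω (n + 2))
    simp only [map_add, M.β_β, M.δ_δ, add_zero, zero_add]
    exact (add_comm _ _).trans this

/-- The cochain complex `⁺C_β`: in degree `r` it is `∏_{k ≥ 0} C^{r-2k}`, seen as the space of
sequences with `ω_n = 0` unless `n = r - 2k` with `k ≥ 0`. -/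
def plus (M : MixedComplex.{u, v} κ) : CochainCx.{u, v} κ where
  T := ∀ n, M.C n
  D := M.totD
  deg r :=
    { carrier := {ω | ∀ n : ℕ, ¬ ((n : ℤ) ≤ r ∧ Even (r - n)) → ω n = 0}
      add_mem' := fun hx hy n hn => by simp [hx n hn, hy n hn]
      zero_mem' := fun _ _ => rfl
      smul_mem' := fun c x hx n hn => by simp [hx n hn] }
  D_mem r ω hω n hn := by
    have hω : ∀ n : ℕ, ¬ ((n : ℤ) ≤ r ∧ Even (r - n)) → ω n = 0 := hω
    have key : ∀ m : ℕ, ((m : ℤ) = n - 1 ∨ (m : ℤ) = n + 1) → ω m = 0 := by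
      intro m hm
      refine hω m fun h => hn ?_
      obtain ⟨h1, h2⟩ := h
      rw [Int.even_iff] at h2 ⊢
      omega
    match n with
    | 0 => change M.β 0 (ω 1) = 0; rw [key 1 (by simp)]; simp
    | n + 1 =>
      change M.δ n (ω n) + M.β (n + 1) (ω (n + 2)) = 0
      rw [key n (by push_cast; left; ring), key (n + 2) (by push_cast; right; ring)]; simp
  D_D := M.totD_totD

/-- The 2-periodic complex `ℙC`: in degree `r` it is the direct product of all `C^n`, `n ≥ 0`,
`n ≡ r mod 2`, seen as the space of sequences with `ω_n = 0` unless `n ≡ r mod 2`. -/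
def periodic (M : MixedComplex.{u, v} κ) : CochainCx.{u, v} κ where
  T := ∀ n, M.C n
  D := M.totD
  deg r :=
    { carrier := {ω | ∀ n : ℕ, ¬ Even (r - n) → ω n = 0}
      add_mem' := fun hx hy n hn => by simp [hx n hn, hy n hn]
      zero_mem' := fun _ _ => rfl
      smul_mem' := fun c x hx n hn => by simp [hx n hn] }
  D_mem r ω hω n hn := by
    have hω : ∀ n : ℕ, ¬ Even (r - n) → ω n = 0 := hω
    have key : ∀ m : ℕ, ((m : ℤ) = n - 1 ∨ (m : ℤ) = n + 1) → ω m = 0 := by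
      intro m hm
      refine hω m fun h => hn ?_
      rw [Int.even_iff] at h ⊢
      omega
    match n with
    | 0 => change M.β 0 (ω 1) = 0; rw [key 1 (by simp)]; simp
    | n + 1 =>
      change M.δ n (ω n) + M.β (n + 1) (ω (n + 2)) = 0
      rw [key n (by push_cast; left; ring), key (n + 2) (by push_cast; right; ring)]; simp
  D_D := M.totD_totD

/-- The inclusion `I^{*-2} : ⁺C_β^{*-2} → ℙC^*`. -/
def incl (M : MixedComplex.{u, v} κ) : CochainCx.Hom (M.plus.reindex (-2)) M.periodic where
  f := LinearMap.id
  f_mem r x hx n hn := by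
    refine hx n fun h => hn ?_
    obtain ⟨_, h2⟩ := h
    rw [Int.even_iff] at h2 ⊢
    omega
  comm _ := rfl

/-- Morphisms of mixed complexes. -/
structure Hom (M : MixedComplex.{u, v} κ) (N : MixedComplex.{u, w} κ) where
  f : ∀ n, M.C n →ₗ[κ] N.C n
  comm_δ : ∀ n x, f (n + 1) (M.δ n x) = N.δ n (f n x)
  comm_β : ∀ n x, f n (M.β n x) = N.β n (f (n + 1) x)

namespace Hom

variable {M : MixedComplex.{u, v} κ} {N : MixedComplex.{u, w} κ}

/-- The map on `H^n(C, δ)` induced by a morphism. -/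
def mapH (f : Hom M N) (n : ℕ) : M.H n →ₗ[κ] N.H n :=
  Submodule.mapQ _ _ ((f.f n).restrict (fun x (hx : M.δ n x = 0) => by
      change N.δ n (f.f n x) = 0
      rw [← f.comm_δ, hx, map_zero]))
    (by
      rintro ⟨x, hx⟩ hx'
      change f.f n x ∈ N.cob n
      change x ∈ M.cob n at hx'
      cases n with
      | zero =>
        obtain rfl : x = 0 := hx'
        simp
      | succ n =>
        obtain ⟨y, rfl⟩ := hx'
        exact ⟨f.f n y, (f.comm_δ n y).symm⟩)

/-- The map on `∏ₙ C^n` induced by a morphism. -/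
def tot (f : Hom M N) : (∀ n, M.C n) →ₗ[κ] (∀ n, N.C n) :=
  LinearMap.pi fun n => f.f n ∘ₗ LinearMap.proj n

theorem tot_comm (f : Hom M N) (ω : ∀ n, M.C n) : f.tot (M.totD ω) = N.totD (f.tot ω) := by
  funext n
  cases n with
  | zero => exact f.comm_β 0 (ω 1)
  | succ n =>
    change f.f (n + 1) (M.δ n (ω n) + M.β (n + 1) (ω (n + 2))) =
      N.δ n (f.f n (ω n)) + N.β (n + 1) (f.f (n + 2) (ω (n + 2)))
    rw [map_add, f.comm_δ, f.comm_β]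

/-- The morphism of complexes `⁺C_β(M) → ⁺C_β(N)` induced by a morphism. -/
def plus (f : Hom M N) : CochainCx.Hom M.plus N.plus where
  f := f.tot
  f_mem r ω hω n hn := by
    change f.f n (ω n) = 0
    rw [show ω n = 0 from hω n hn, map_zero]
  comm := f.tot_comm

/-- The morphism of complexes `ℙC(M) → ℙC(N)` induced by a morphism. -/
def periodic (f : Hom M N) : CochainCx.Hom M.periodic N.periodic where
  f := f.tot
  f_mem r ω hω n hn := by
    change f.f n (ω n) = 0
    rw [show ω n = 0 from hω n hn, map_zero]
  comm := f.tot_comm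

end Hom

/-- `∏ H^n(C, δ)`, over all `n ≥ 0` with `n ≡ r mod 2`. -/
abbrev prodH (M : MixedComplex.{u, v} κ) (r : ℤ) : Type v :=
  ∀ n : {n : ℕ // Even (r - n)}, M.H n

/-- The map on `∏ H^n` induced by a morphism of mixed complexes. -/
def Hom.mapProdH {M : MixedComplex.{u, v} κ} {N : MixedComplex.{u, w} κ} (f : Hom M N) (r : ℤ) :
    M.prodH r →ₗ[κ] N.prodH r :=
  LinearMap.pi fun n => f.mapH n ∘ₗ LinearMap.proj n

/-- When `β = 0`, the map `H^r(ℙC) → ∏ H^n(C, δ)`, `[ω] ↦ ([ω_n])_n`. -/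
def periodicToProd (M : MixedComplex.{u, v} κ) (hβ : ∀ n, M.β n = 0) (r : ℤ) :
    M.periodic.H r →ₗ[κ] M.prodH r :=
  LinearMap.pi fun n =>
    Submodule.mapQ _ _
      (LinearMap.restrict (p := M.periodic.Z r) (q := LinearMap.ker (M.δ n))
        (LinearMap.proj (n : ℕ)) (fun ω hω => by
          have h : M.totD ω = 0 := hω.2
          have h' : M.δ n (ω n) + M.β (n + 1) (ω (n + 2)) = 0 := congrFun h ((n : ℕ) + 1)
          rw [hβ] at h'
          change M.δ n (ω n) = 0
          simpa using h'))
      (by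
        rintro ⟨ω, hω⟩ ⟨η, hη, h⟩
        change M.totD η = ω at h
        subst h
        obtain ⟨n, hn⟩ := n
        change M.totFun η n ∈ M.cob n
        cases n with
        | zero =>
          change M.β 0 (η 1) = 0
          rw [hβ]; rfl
        | succ n =>
          refine ⟨η n, ?_⟩
          change M.δ n (η n) = M.δ n (η n) + M.β (n + 1) (η (n + 2))
          rw [hβ]; simp)

theorem periodicToProd_bijective (M : MixedComplex.{u, v} κ) (hβ : ∀ n, M.β n = 0) (r : ℤ) :
    Function.Bijective (M.periodicToProd hβ r) := by
  classical
  constructor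
  · rw [← LinearMap.ker_eq_bot, LinearMap.ker_eq_bot']
    intro x hx
    obtain ⟨⟨ω, hω⟩, rfl⟩ := Submodule.Quotient.mk_surjective _ x
    have h1 : ∀ n : ℕ, ω n ∈ M.cob n := by
      intro n
      by_cases hn : Even (r - n)
      · have := congrFun hx ⟨n, hn⟩
        have h2 := (Submodule.Quotient.mk_eq_zero ((M.cob n).submoduleOf _)).1 this
        exact h2
      · rw [show ω n = 0 from hω.1 n hn]; exact zero_mem _
    have h2 : ∀ n : ℕ, ∃ y, M.δ n y = ω (n + 1) := fun n => h1 (n + 1)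
    choose y hy using h2
    refine (Submodule.Quotient.mk_eq_zero _).2 ?_
    refine ⟨fun n => if Even (r - 1 - n) then y n else 0, ?_, ?_⟩
    · intro n hn
      simp [hn]
    · change M.totFun (fun n => if Even (r - 1 - (n : ℤ)) then y n else 0) = ω
      funext n
      cases n with
      | zero =>
        have : ω 0 = 0 := h1 0
        simp [totFun, hβ, this]
      | succ n =>
        by_cases hn : Even (r - 1 - n)
        · simp [totFun, hβ, hn, hy]
        · have : ω (n + 1) = 0 := hω.1 (n + 1) (by
            intro h; apply hn
            rw [Int.even_iff] at h ⊢
            push_cast at h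
            omega)
          simp [totFun, hβ, hn, this]
  · intro x
    have h : ∀ n : {n : ℕ // Even (r - n)}, ∃ z : LinearMap.ker (M.δ n),
        Submodule.Quotient.mk z = x n := fun n => Submodule.Quotient.mk_surjective _ (x n)
    choose z hz using h
    let ω : ∀ n, M.C n := fun n => if hn : Even (r - n) then (z ⟨n, hn⟩).1 else 0
    have hω : ω ∈ M.periodic.Z r := by
      refine ⟨fun n hn => by simp [ω, hn], ?_⟩
      change M.totFun ω = 0
      funext n
      cases n with
      | zero => simp [totFun, hβ]
      | succ n =>
        by_cases hn : Even (r - n)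
        · have := (z ⟨n, hn⟩).2
          have h3 : M.δ n (z ⟨n, hn⟩).1 = 0 := this
          simp [totFun, hβ, ω, hn, h3]
        · simp [totFun, hβ, ω, hn]
    refine ⟨Submodule.Quotient.mk ⟨ω, hω⟩, ?_⟩
    funext n
    rw [← hz n]
    change Submodule.Quotient.mk _ = _
    congr 1
    apply Subtype.ext
    change ω n = _
    simp [ω, n.2]

/-- When `β = 0`, the identification `H^r(ℙC) = ∏ H^n(C, δ)`. -/
noncomputable def periodicEquiv (M : MixedComplex.{u, v} κ) (hβ : ∀ n, M.β n = 0) (r : ℤ) :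
    M.periodic.H r ≃ₗ[κ] M.prodH r :=
  LinearEquiv.ofBijective _ (M.periodicToProd_bijective hβ r)

end MixedComplex

/-! ## Commutative differential graded algebras -/

section CDGA

variable {κ : Type u} [Field κ]

/-- Graded commutativity, `a b = (-1)^{mn} b a` for `a` of degree `m` and `b` of degree `n`. -/
def GradedCommutative {A : Type v} [Ring A] [Algebra κ A] (𝒜 : ℕ → Submodule κ A) : Prop :=
  ∀ m n : ℕ, ∀ a ∈ 𝒜 m, ∀ b ∈ 𝒜 n, a * b = (-1 : A) ^ (m * n) * (b * a)

/-- An exterior differential on a graded algebra. -/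
structure ExteriorDifferential {A : Type v} [Ring A] [Algebra κ A] (𝒜 : ℕ → Submodule κ A) where
  d : A →ₗ[κ] A
  d_mem : ∀ n : ℕ, ∀ a ∈ 𝒜 n, d a ∈ 𝒜 (n + 1)
  leibniz : ∀ n : ℕ, ∀ a ∈ 𝒜 n, ∀ b : A, d (a * b) = d a * b + (-1 : A) ^ n * (a * d b)
  d_d : ∀ a : A, d (d a) = 0

/-- The cochain complex `(A^*, d)`, as the mixed complex `(A^*, d, 0)`. -/
def ExteriorDifferential.mixed {A : Type v} [Ring A] [Algebra κ A] {𝒜 : ℕ → Submodule κ A}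
    (d : ExteriorDifferential 𝒜) : MixedComplex.{u, v} κ where
  C n := 𝒜 n
  δ n := d.d.restrict (d.d_mem n)
  β _ := 0
  δ_δ n x := Subtype.ext (d.d_d x)
  β_β _ _ := rfl
  β_δ_zero _ := rfl
  β_δ _ _ := by simp

theorem ExteriorDifferential.mixed_β {A : Type v} [Ring A] [Algebra κ A] {𝒜 : ℕ → Submodule κ A}
    (d : ExteriorDifferential 𝒜) (n : ℕ) : d.mixed.β n = 0 := rfl

/-- A CDGA `(A, d)` is homologically 1-connected: `H^0(A, d) = κ` and `H^1(A, d) = 0`. -/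
structure HomologicallyOneConnected {A : Type v} [Ring A] [Algebra κ A]
    {𝒜 : ℕ → Submodule κ A} (d : ExteriorDifferential 𝒜) : Prop where
  H0 : Module.finrank κ (d.mixed.H 0) = 1
  H1 : Subsingleton (d.mixed.H 1)

/-- Morphisms of CDGAs: unital algebra homomorphisms that preserve degrees and differentials. -/
structure CDGAHom {A : Type v} [Ring A] [Algebra κ A] {𝒜 : ℕ → Submodule κ A}
    {B : Type w} [Ring B] [Algebra κ B] {ℬ : ℕ → Submodule κ B}
    (dA : ExteriorDifferential 𝒜) (dB : ExteriorDifferential ℬ) where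
  f : A →ₐ[κ] B
  f_mem : ∀ n : ℕ, ∀ a ∈ 𝒜 n, f a ∈ ℬ n
  comm : ∀ a : A, f (dA.d a) = dB.d (f a)

namespace CDGAHom

variable {A : Type v} [Ring A] [Algebra κ A] {𝒜 : ℕ → Submodule κ A}
    {B : Type w} [Ring B] [Algebra κ B] {ℬ : ℕ → Submodule κ B}
    {dA : ExteriorDifferential 𝒜} {dB : ExteriorDifferential ℬ}

/-- The underlying morphism of complexes. -/
def mixed (θ : CDGAHom dA dB) : MixedComplex.Hom dA.mixed dB.mixed where
  f n := θ.f.toLinearMap.restrict (θ.f_mem n)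
  comm_δ _ x := Subtype.ext (θ.comm x.1)
  comm_β _ _ := map_zero _

/-- A quasi-isomorphism: `H^n(θ)` is an isomorphism for every `n`. -/
def IsQuasiIso (θ : CDGAHom dA dB) : Prop := ∀ n : ℕ, Function.Bijective (θ.mixed.mapH n)

end CDGAHom

end CDGA

/-! ## The free commutative graded algebra -/

section Free

variable (κ : Type u) [Field κ] (W : ℕ → Type v) [∀ n, AddCommGroup (W n)] [∀ n, Module κ (W n)]

/-- The relations `x y = (-1)^{ij} y x`, `x ∈ W^i`, `y ∈ W^j`, in the tensor algebra of `⊕ W^n`. -/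
inductive FreeCGA.Rel : TensorAlgebra κ (⨁ n, W n) → TensorAlgebra κ (⨁ n, W n) → Prop
  | comm (i j : ℕ) (x : W i) (y : W j) : FreeCGA.Rel
      (TensorAlgebra.ι κ (DirectSum.lof κ ℕ W i x) * TensorAlgebra.ι κ (DirectSum.lof κ ℕ W j y))
      ((-1) ^ (i * j) *
        (TensorAlgebra.ι κ (DirectSum.lof κ ℕ W j y) * TensorAlgebra.ι κ (DirectSum.lof κ ℕ W i x)))

/-- The free commutative graded algebra `Λ[W]` generated by the graded vector space `W`
(over a field of characteristic different from 2, where the relations above imply `x² = 0` for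
`x` of odd degree). -/
def FreeCGA : Type (max u v) := RingQuot (FreeCGA.Rel κ W)

namespace FreeCGA

noncomputable instance : Ring (FreeCGA κ W) := inferInstanceAs (Ring (RingQuot (FreeCGA.Rel κ W)))

noncomputable instance : Algebra κ (FreeCGA κ W) :=
  inferInstanceAs (Algebra κ (RingQuot (FreeCGA.Rel κ W)))

variable {W}

/-- The generators: the inclusion `W^n → Λ[W]`. -/
noncomputable def ι (n : ℕ) : W n →ₗ[κ] FreeCGA κ W :=
  (RingQuot.mkAlgHom κ (FreeCGA.Rel κ W)).toLinearMap ∘ₗ TensorAlgebra.ι κ ∘ₗ DirectSum.lof κ ℕ W n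

variable {κ}

theorem ι_comm {i j : ℕ} (x : W i) (y : W j) :
    ι κ i x * ι κ j y = (-1) ^ (i * j) * (ι κ j y * ι κ i x) := by
  have h := RingQuot.mkAlgHom_rel κ (FreeCGA.Rel.comm (κ := κ) (W := W) i j x y)
  simp only [map_mul, map_pow, map_neg, map_one] at h
  exact h

/-- The universal property of `Λ[W]`. -/
noncomputable def lift {B : Type w} [Ring B] [Algebra κ B] (f : ∀ n, W n →ₗ[κ] B)
    (hf : ∀ i j (x : W i) (y : W j), f i x * f j y = (-1) ^ (i * j) * (f j y * f i x)) :
    FreeCGA κ W →ₐ[κ] B :=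
  RingQuot.liftAlgHom κ ⟨TensorAlgebra.lift κ (DirectSum.toModule κ ℕ B f), by
    rintro _ _ ⟨i, j, x, y⟩
    simpa using hf i j x y⟩

@[simp] theorem lift_ι {B : Type w} [Ring B] [Algebra κ B] (f : ∀ n, W n →ₗ[κ] B)
    (hf : ∀ i j (x : W i) (y : W j), f i x * f j y = (-1) ^ (i * j) * (f j y * f i x))
    (n : ℕ) (x : W n) : lift f hf (ι κ n x) = f n x := by
  have h : lift f hf (ι κ n x) =
      RingQuot.liftAlgHom κ ⟨TensorAlgebra.lift κ (DirectSum.toModule κ ℕ B f), by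
        rintro _ _ ⟨i, j, x, y⟩
        simpa using hf i j x y⟩ (RingQuot.mkAlgHom κ (FreeCGA.Rel κ W)
          (TensorAlgebra.ι κ (DirectSum.lof κ ℕ W n x))) := rfl
  rw [h, RingQuot.liftAlgHom_mkAlgHom_apply]
  simp

theorem algHom_ext {B : Type w} [Ring B] [Algebra κ B] {f g : FreeCGA κ W →ₐ[κ] B}
    (h : ∀ n (x : W n), f (ι κ n x) = g (ι κ n x)) : f = g := by
  apply RingQuot.ringQuot_ext'
  apply TensorAlgebra.hom_ext
  apply DirectSum.linearMap_ext
  intro n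
  ext x
  exact h n x

variable (κ W)

/-- The component of degree `n` of `Λ[W]`: the span of the products of homogeneous generators
whose degrees add up to `n`. -/
noncomputable def grading (n : ℕ) : Submodule κ (FreeCGA κ W) :=
  Submodule.span κ {a | ∃ l : List (Σ n, W n),
    (l.map Sigma.fst).sum = n ∧ (l.map fun s => ι κ s.1 s.2).prod = a}

variable {κ W}

theorem prod_mem (l : List (Σ n, W n)) :
    (l.map fun s => ι κ s.1 s.2).prod ∈ grading κ W (l.map Sigma.fst).sum :=
  Submodule.subset_span ⟨l, rfl, rfl⟩

theorem ι_mem (n : ℕ) (x : W n) : ι κ n x ∈ grading κ W n := by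
  simpa using prod_mem (κ := κ) [(⟨n, x⟩ : Σ n, W n)]

instance : SetLike.GradedMonoid (grading κ W) where
  one_mem := by simpa using prod_mem (κ := κ) ([] : List (Σ n, W n))
  mul_mem := by
    intro i j a b ha hb
    have h : grading κ W i * grading κ W j ≤ grading κ W (i + j) := by
      rw [grading, grading, Submodule.span_mul_span, Submodule.span_le]
      rintro _ ⟨_, ⟨l, rfl, rfl⟩, _, ⟨l', rfl, rfl⟩, rfl⟩
      have := prod_mem (κ := κ) (l ++ l')
      simpa using this
    exact h (Submodule.mul_mem_mul ha hb)

theorem mul_mem_of_eq {i j k : ℕ} (h : i + j = k) {a b : FreeCGA κ W} (ha : a ∈ grading κ W i)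
    (hb : b ∈ grading κ W j) : a * b ∈ grading κ W k :=
  h ▸ SetLike.GradedMul.mul_mem ha hb

theorem sign_mul_mem {n k : ℕ} {a : FreeCGA κ W} (ha : a ∈ grading κ W n) :
    (-1) ^ k * a ∈ grading κ W n := by
  rcases neg_one_pow_eq_or (FreeCGA κ W) k with h | h <;> rw [h] <;> simpa using ha

theorem ring_neg_one_mul {R : Type w} [Ring R] (a : R) : -1 * a = -a := by simp

/-- The degree decomposition, as an algebra homomorphism. -/
noncomputable def decomp : FreeCGA κ W →ₐ[κ] ⨁ n, grading κ W n :=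
  lift (B := ⨁ n, grading κ W n) (fun n => DirectSum.lof κ ℕ (fun n => grading κ W n) n ∘ₗ
      (ι κ n).codRestrict (grading κ W n) (ι_mem n)) (by
    intro i j x y
    simp only [LinearMap.comp_apply, DirectSum.lof_eq_of]
    have hc : (DirectSum.of (fun n => grading κ W n) j ((ι κ j).codRestrict _ (ι_mem j) y) *
        DirectSum.of (fun n => grading κ W n) i ((ι κ i).codRestrict _ (ι_mem i) x)) =
        DirectSum.of (fun n => grading κ W n) (i + j)
          ⟨ι κ j y * ι κ i x, by
            rw [add_comm]; exact SetLike.GradedMul.mul_mem (ι_mem j y) (ι_mem i x)⟩ := by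
      rw [DirectSum.of_mul_of]
      exact DirectSum.of_eq_of_gradedMonoid_eq (Sigma.subtype_ext (add_comm j i) rfl)
    rw [hc, DirectSum.of_mul_of]
    rcases neg_one_pow_eq_or ℤ (i * j) with h | h
    · have h1 : ((-1 : ⨁ n, grading κ W n)) ^ (i * j) = 1 := by
        have := congrArg (Int.cast : ℤ → ⨁ n, grading κ W n) h; simpa using this
      have h2 : ((-1 : FreeCGA κ W)) ^ (i * j) = 1 := by
        have := congrArg (Int.cast : ℤ → FreeCGA κ W) h; simpa using this
      rw [h1, one_mul]
      congr 1
      apply Subtype.ext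
      change ι κ i x * ι κ j y = ι κ j y * ι κ i x
      rw [ι_comm, h2, one_mul]
    · have h1 := congrArg (Int.cast : ℤ → ⨁ n, grading κ W n) h
      simp only [Int.cast_pow, Int.cast_neg, Int.cast_one] at h1
      have h2 : ((-1 : FreeCGA κ W)) ^ (i * j) = -1 := by
        have := congrArg (Int.cast : ℤ → FreeCGA κ W) h; simpa using this
      rw [h1]
      refine Eq.trans ?_ (ring_neg_one_mul _).symm
      rw [← map_neg]
      congr 1
      apply Subtype.ext
      change ι κ i x * ι κ j y = -(ι κ j y * ι κ i x)
      rw [ι_comm, h2, neg_one_mul])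

theorem decomp_ι (n : ℕ) (x : W n) : decomp (ι κ n x) =
    DirectSum.of (fun n => grading κ W n) n ⟨ι κ n x, ι_mem n x⟩ := by
  rw [decomp, lift_ι]; rfl

theorem decomp_prod (l : List (Σ n, W n)) :
    decomp (l.map fun s => ι κ s.1 s.2).prod =
      DirectSum.of (fun n => grading κ W n) _ ⟨_, prod_mem (κ := κ) l⟩ := by
  induction l with
  | nil => simp only [List.map_nil, List.prod_nil, map_one]; rfl
  | cons s l ih =>
    simp only [List.map_cons, List.prod_cons, map_mul, ih]
    rw [decomp_ι, DirectSum.of_mul_of]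
    exact DirectSum.of_eq_of_gradedMonoid_eq (Sigma.subtype_ext rfl rfl)

noncomputable instance : GradedAlgebra (grading κ W) :=
  GradedAlgebra.ofAlgHom (grading κ W) decomp
    (by
      apply algHom_ext
      intro n x
      change DirectSum.coeAlgHom (grading κ W) (decomp (ι κ n x)) = ι κ n x
      rw [decomp_ι, DirectSum.coeAlgHom_of])
    (by
      rintro i ⟨a, ha⟩
      change decomp a = _
      induction ha using Submodule.span_induction with
      | mem x hx =>
        obtain ⟨l, rfl, rfl⟩ := hx
        exact decomp_prod l
      | zero =>
        rw [map_zero]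
        exact (map_zero (DirectSum.of (fun n => grading κ W n) i)).symm
      | add x y hx hy ihx ihy =>
        rw [map_add, ihx, ihy, ← map_add]; rfl
      | smul c x hx ih =>
        rw [map_smul, ih, ← DirectSum.lof_eq_of κ, ← map_smul]; rfl)

/-- Induction on products of generators, for linear maps. -/
theorem linearMap_ext {B : Type w} [AddCommGroup B] [Module κ B] {f g : FreeCGA κ W →ₗ[κ] B}
    (h1 : f 1 = g 1)
    (h : ∀ n (x : W n) (a : FreeCGA κ W), f a = g a → f (ι κ n x * a) = g (ι κ n x * a)) :
    f = g := by
  have hl : ∀ l : List (Σ n, W n), f (l.map fun s => ι κ s.1 s.2).prod =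
      g (l.map fun s => ι κ s.1 s.2).prod := by
    intro l
    induction l with
    | nil => simpa using h1
    | cons s l ih => simpa using h s.1 s.2 _ ih
  have hg : ∀ n, ∀ a ∈ grading κ W n, f a = g a := by
    intro n a ha
    induction ha using Submodule.span_induction with
    | mem x hx => obtain ⟨l, rfl, rfl⟩ := hx; exact hl l
    | zero => simp
    | add x y _ _ hx hy => simp [hx, hy]
    | smul c x _ hx => simp [hx]
  ext a
  induction a using DirectSum.Decomposition.inductionOn (grading κ W) with
  | zero => simp
  | homogeneous a => exact hg _ _ a.2
  | add a b ha hb => simp [ha, hb]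

theorem sign_comm (k : ℕ) (a b : FreeCGA κ W) : a * ((-1) ^ k * b) = (-1) ^ k * (a * b) := by
  rcases neg_one_pow_eq_or (FreeCGA κ W) k with h | h <;> simp [h]

theorem ι_graded_comm {i n : ℕ} (x : W i) {a : FreeCGA κ W} (ha : a ∈ grading κ W n) :
    ι κ i x * a = (-1) ^ (i * n) * (a * ι κ i x) := by
  induction ha using Submodule.span_induction with
  | mem a ha =>
    obtain ⟨l, rfl, rfl⟩ := ha
    induction l with
    | nil => simp
    | cons s l ih =>
      simp only [List.map_cons, List.prod_cons, List.sum_cons]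
      rw [← mul_assoc, ι_comm, mul_assoc, mul_assoc, ih, sign_comm, ← mul_assoc, ← pow_add,
        mul_add, mul_assoc]
  | zero => simp
  | add a b _ _ ha hb => simp only [mul_add, add_mul, ha, hb]
  | smul c a _ ha => simp only [mul_smul_comm, smul_mul_assoc, ha]

theorem gradedCommutative : GradedCommutative (grading κ W) := by
  intro m n a ha b hb
  induction ha using Submodule.span_induction with
  | mem a ha =>
    obtain ⟨l, rfl, rfl⟩ := ha
    induction l with
    | nil => simp
    | cons s l ih =>
      simp only [List.map_cons, List.prod_cons, List.sum_cons]
      rw [mul_assoc, ih, sign_comm, ← mul_assoc (ι κ s.1 s.2), ι_graded_comm s.2 hb, mul_assoc,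
        mul_assoc, ← mul_assoc, ← pow_add, add_mul, add_comm]
  | zero => simp
  | add a b _ _ ha hb => simp only [mul_add, add_mul, ha, hb]
  | smul c a _ ha => simp only [mul_smul_comm, smul_mul_assoc, ha]

/-- The parity automorphism, `a ↦ (-1)^n a` on the elements of degree `n`. -/
noncomputable def parity : FreeCGA κ W →ₐ[κ] FreeCGA κ W :=
  lift (fun n => (-1 : κ) ^ n • ι κ n) (by
    intro i j x y
    simp only [LinearMap.smul_apply, smul_mul_smul_comm]
    rw [ι_comm x y, mul_smul_comm, mul_comm])

@[simp] theorem parity_ι (n : ℕ) (x : W n) : parity (ι κ n x) = (-1) ^ n * ι κ n x := by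
  rw [parity, lift_ι]
  rcases Nat.even_or_odd n with h | h <;> simp [h.neg_one_pow]

theorem parity_mem {n : ℕ} {a : FreeCGA κ W} (ha : a ∈ grading κ W n) :
    parity a = (-1) ^ n * a := by
  induction ha using Submodule.span_induction with
  | mem a ha =>
    obtain ⟨l, rfl, rfl⟩ := ha
    induction l with
    | nil => simp
    | cons s l ih =>
      simp only [List.map_cons, List.prod_cons, List.sum_cons, map_mul, ih, parity_ι]
      rw [mul_assoc, sign_comm, ← mul_assoc, ← pow_add]
  | zero => simp
  | add a b _ _ ha hb => simp only [mul_add, map_add, ha, hb]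
  | smul c a _ ha => simp only [mul_smul_comm, map_smul, ha]

/-- The homomorphism `a ↦ !![σ a, D a; 0, a]`, `σ` the parity automorphism, where `D` is the odd
derivation that extends the given map on generators. -/
noncomputable def derivHom (f : ∀ n, W n →ₗ[κ] FreeCGA κ W)
    (hf : ∀ i j (x : W i) (y : W j),
      f i x * ι κ j y = (-1) ^ ((i + 1) * j) * (ι κ j y * f i x)) :
    FreeCGA κ W →ₐ[κ] Matrix (Fin 2) (Fin 2) (FreeCGA κ W) :=
  lift (fun n =>
    { toFun := fun x => !![(-1) ^ n * ι κ n x, f n x; 0, ι κ n x]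
      map_add' := fun x y => by
        ext i j; fin_cases i <;> fin_cases j <;> simp [mul_add]
      map_smul' := fun c x => by
        ext i j; fin_cases i <;> fin_cases j <;> simp }) (by
    intro i j x y
    have hs : ((-1 : Matrix (Fin 2) (Fin 2) (FreeCGA κ W)) ^ (i * j)) =
        (if Even (i * j) then 1 else -1) := by
      split_ifs with h
      · exact h.neg_one_pow
      · exact (Nat.not_even_iff_odd.1 h).neg_one_pow
    have hs' : ((-1 : FreeCGA κ W) ^ (i * j)) = (if Even (i * j) then 1 else -1) := by
      split_ifs with h
      · exact h.neg_one_pow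
      · exact (Nat.not_even_iff_odd.1 h).neg_one_pow
    have hc := ι_comm (κ := κ) x y
    have hfx := hf i j x y
    have hfy := hf j i y x
    have e1 : ((i + 1) * j) = i * j + j := by ring
    have e2 : ((j + 1) * i) = i * j + i := by ring
    rw [e1, pow_add] at hfx
    rw [e2, pow_add] at hfy
    have p1 : (-1 : FreeCGA κ W) ^ i = 1 ∨ (-1 : FreeCGA κ W) ^ i = -1 := neg_one_pow_eq_or _ _
    have p2 : (-1 : FreeCGA κ W) ^ j = 1 ∨ (-1 : FreeCGA κ W) ^ j = -1 := neg_one_pow_eq_or _ _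
    rw [hs'] at hc hfx hfy
    rw [hs]
    simp only [LinearMap.coe_mk, AddHom.coe_mk]
    ext a b
    rcases p1 with p1 | p1 <;> rcases p2 with p2 | p2 <;> rw [p1] at hfy ⊢ <;>
      rw [p2] at hfx ⊢ <;> split_ifs at hc hfx hfy ⊢ <;> fin_cases a <;> fin_cases b <;>
      simp [Matrix.mul_apply, Fin.sum_univ_two, hc, hfx, hfy] <;> abel)

/-- The odd derivation of `Λ[W]` that extends a given map on generators. -/
noncomputable def deriv (f : ∀ n, W n →ₗ[κ] FreeCGA κ W)
    (hf : ∀ i j (x : W i) (y : W j),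
      f i x * ι κ j y = (-1) ^ ((i + 1) * j) * (ι κ j y * f i x)) :
    FreeCGA κ W →ₗ[κ] FreeCGA κ W where
  toFun a := derivHom f hf a 0 1
  map_add' a b := by simp
  map_smul' c a := by simp

section deriv

variable (f : ∀ n, W n →ₗ[κ] FreeCGA κ W)
    (hf : ∀ i j (x : W i) (y : W j),
      f i x * ι κ j y = (-1) ^ ((i + 1) * j) * (ι κ j y * f i x))

@[simp] theorem deriv_ι (n : ℕ) (x : W n) : deriv f hf (ι κ n x) = f n x := by
  change derivHom f hf (ι κ n x) 0 1 = f n x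
  rw [derivHom, lift_ι]; rfl

@[simp] theorem deriv_one : deriv f hf 1 = 0 := by
  change derivHom f hf 1 0 1 = 0
  simp

theorem derivHom_diag (a : FreeCGA κ W) :
    derivHom f hf a 0 0 = parity a ∧ derivHom f hf a 1 1 = a ∧ derivHom f hf a 1 0 = 0 := by
  let P : Subalgebra κ (FreeCGA κ W) :=
    { carrier := {a | derivHom f hf a 0 0 = parity a ∧ derivHom f hf a 1 1 = a ∧
        derivHom f hf a 1 0 = 0}
      mul_mem' := by
        rintro a b ⟨h1, h2, h3⟩ ⟨k1, k2, k3⟩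
        refine ⟨?_, ?_, ?_⟩ <;>
          simp [Matrix.mul_apply, Fin.sum_univ_two, h1, h2, h3, k1, k2, k3]
      add_mem' := by
        rintro a b ⟨h1, h2, h3⟩ ⟨k1, k2, k3⟩
        refine ⟨?_, ?_, ?_⟩ <;> simp [h1, h2, h3, k1, k2, k3]
      algebraMap_mem' := by
        intro c
        refine ⟨?_, ?_, ?_⟩ <;> simp [Matrix.algebraMap_matrix_apply] }
  have hP : ∀ l : List (Σ n, W n), (l.map fun s => ι κ s.1 s.2).prod ∈ P := by
    intro l
    refine Subalgebra.list_prod_mem P ?_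
    intro x hx
    obtain ⟨s, _, rfl⟩ := List.mem_map.1 hx
    refine ⟨?_, ?_, ?_⟩
    · rw [parity_ι, derivHom, lift_ι]; rfl
    · rw [derivHom, lift_ι]; rfl
    · rw [derivHom, lift_ι]; rfl
  have hg : ∀ n, grading κ W n ≤ Subalgebra.toSubmodule P := by
    intro n
    refine Submodule.span_le.2 ?_
    rintro _ ⟨l, rfl, rfl⟩
    exact hP l
  change a ∈ P
  induction a using DirectSum.Decomposition.inductionOn (grading κ W) with
  | zero => exact zero_mem _
  | homogeneous a => exact hg _ a.2
  | add a b ha hb => exact add_mem ha hb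

theorem deriv_mul (a b : FreeCGA κ W) :
    deriv f hf (a * b) = deriv f hf a * b + parity a * deriv f hf b := by
  change derivHom f hf (a * b) 0 1 = derivHom f hf a 0 1 * b + parity a * derivHom f hf b 0 1
  rw [map_mul, Matrix.mul_apply, Fin.sum_univ_two, (derivHom_diag f hf a).1,
    (derivHom_diag f hf b).2.1, add_comm]

theorem parity_parity (a : FreeCGA κ W) : parity (parity a) = a := by
  have : (parity (κ := κ) (W := W)).comp parity = AlgHom.id κ _ := by
    apply algHom_ext
    intro n x
    rcases neg_one_pow_eq_or (FreeCGA κ W) n with h | h <;> simp [h]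
  exact DFunLike.congr_fun this a

/-- An odd derivation anticommutes with the parity automorphism if it does so on generators. -/
theorem deriv_parity
    (hp : ∀ n (x : W n), parity (f n x) = -((-1) ^ n * f n x)) (a : FreeCGA κ W) :
    deriv f hf (parity a) = -parity (deriv f hf a) := by
  have : deriv f hf ∘ₗ parity.toLinearMap = -(parity.toLinearMap ∘ₗ deriv f hf) := by
    apply linearMap_ext
    · simp
    · intro n x a ha
      replace ha : deriv f hf (parity a) = -parity (deriv f hf a) := ha
      change deriv f hf (parity (ι κ n x * a)) = -parity (deriv f hf (ι κ n x * a))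
      rcases neg_one_pow_eq_or (FreeCGA κ W) n with h | h <;>
        simp [deriv_mul, ha, hp, h] <;> abel
  exact DFunLike.congr_fun this a

end deriv

end FreeCGA

end Free

/-! ## The free loop construction -/

section Loop

variable {κ : Type u} [Field κ] {V : ℕ → Type v} [∀ n, AddCommGroup (V n)]
  [∀ n, Module κ (V n)]

/-- The graded vector space `V ⊕ V̄`, where `V̄^n = V^{n+1}`. -/
abbrev LoopGen (V : ℕ → Type v) (n : ℕ) : Type v := V n × V (n + 1)

variable (κ V) in
/-- The algebra `Λ[V ⊕ V̄]`. -/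
abbrev LoopAlg : Type (max u v) := FreeCGA κ (LoopGen V)

namespace Loop

open FreeCGA

variable (κ) in
/-- The generator `v ∈ V^n` of `Λ[V ⊕ V̄]`. -/
noncomputable def gen (n : ℕ) : V n →ₗ[κ] LoopAlg κ V := ι κ n ∘ₗ LinearMap.inl κ (V n) (V (n + 1))

variable (κ) in
/-- The generator `v̄ ∈ V̄^n` of `Λ[V ⊕ V̄]`, for `v ∈ V^{n+1}`. -/
noncomputable def genBar (n : ℕ) : V (n + 1) →ₗ[κ] LoopAlg κ V :=
  ι κ n ∘ₗ LinearMap.inr κ (V n) (V (n + 1))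

theorem gen_mem (n : ℕ) (v : V n) : gen κ n v ∈ grading κ (LoopGen V) n := ι_mem _ _

theorem genBar_mem (n : ℕ) (v : V (n + 1)) : genBar κ n v ∈ grading κ (LoopGen V) n := ι_mem _ _

theorem ι_eq (n : ℕ) (x : LoopGen V n) : ι κ n x = gen κ n x.1 + genBar κ n x.2 := by
  simp only [gen, genBar, LinearMap.comp_apply, ← map_add]
  simp

/-- The inclusion `Λ[V] → Λ[V ⊕ V̄]`. -/
noncomputable def incl : FreeCGA κ V →ₐ[κ] LoopAlg κ V := lift (gen κ) fun _ _ _ _ => ι_comm _ _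

/-- The projection `Λ[V ⊕ V̄] → Λ[V]` on the component of weight zero: it is the identity on `V`
and vanishes on `V̄`. -/
noncomputable def proj : LoopAlg κ V →ₐ[κ] FreeCGA κ V :=
  lift (fun n => ι κ n ∘ₗ LinearMap.fst κ (V n) (V (n + 1))) fun _ _ _ _ => ι_comm _ _

/-- `i^V` on generators: `v ↦ v̄`, `v̄ ↦ 0`. -/
noncomputable def iGen : ∀ n, LoopGen V n →ₗ[κ] LoopAlg κ V
  | 0 => 0
  | n + 1 => genBar κ n ∘ₗ LinearMap.fst κ (V (n + 1)) (V (n + 2))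

theorem odd_comm {i n j : ℕ} (h : Even (n + (i + 1))) {a : LoopAlg κ V}
    (ha : a ∈ grading κ (LoopGen V) n) (y : LoopGen V j) :
    a * ι κ j y = (-1) ^ ((i + 1) * j) * (ι κ j y * a) := by
  rw [gradedCommutative n j a ha _ (ι_mem j y)]
  congr 1
  rcases Nat.even_or_odd j with hj | hj
  · rw [(hj.mul_left n).neg_one_pow, (hj.mul_left (i + 1)).neg_one_pow]
  · rcases Nat.even_or_odd n with hn | hn
    · have hi : Even (i + 1) := by rw [Nat.even_add] at h; exact h.1 hn
      rw [(hn.mul_right j).neg_one_pow, (hi.mul_right j).neg_one_pow]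
    · have hi : Odd (i + 1) := by
        rw [Nat.even_add] at h
        exact Nat.not_even_iff_odd.1 fun h' => (Nat.not_even_iff_odd.2 hn) (h.2 h')
      rw [(hn.mul hj).neg_one_pow, (hi.mul hj).neg_one_pow]

/-- The interior differential `i^V` of `Λ[V ⊕ V̄]`: the derivation of degree `-1` with
`i^V(v) = v̄` and `i^V(v̄) = 0`. -/
noncomputable def i : LoopAlg κ V →ₗ[κ] LoopAlg κ V :=
  deriv iGen (by
    intro i j x y
    cases i with
    | zero => simp [iGen]
    | succ i => exact odd_comm (n := i) ⟨i + 1, by ring⟩ (genBar_mem _ _) y)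

@[simp] theorem i_ι (n : ℕ) (x : LoopGen V n) : i (ι κ n x) = iGen n x := deriv_ι _ _ _ _

@[simp] theorem i_one : i (1 : LoopAlg κ V) = 0 := deriv_one _ _

theorem i_mul (a b : LoopAlg κ V) : i (a * b) = i a * b + parity a * i b := deriv_mul _ _ _ _

@[simp] theorem i_gen (n : ℕ) (v : V (n + 1)) : i (gen κ (n + 1) v) = genBar κ n v := by
  rw [gen, LinearMap.comp_apply, i_ι]; rfl

@[simp] theorem i_genBar (n : ℕ) (v : V (n + 1)) : i (genBar κ n v) = 0 := by
  rw [genBar, LinearMap.comp_apply, i_ι]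
  cases n <;> simp [iGen]

theorem i_parity (a : LoopAlg κ V) : i (parity a) = -parity (i a) := by
  refine deriv_parity _ _ ?_ a
  intro n x
  cases n with
  | zero => simp [iGen]
  | succ n =>
    have h := parity_mem (genBar_mem (κ := κ) n x.1)
    change parity (genBar κ n x.1) = -((-1) ^ (n + 1) * genBar κ n x.1)
    rw [h, pow_succ]; simp

theorem i_i (a : LoopAlg κ V) : i (i a) = 0 := by
  have : i ∘ₗ i = (0 : LoopAlg κ V →ₗ[κ] LoopAlg κ V) := by
    apply linearMap_ext
    · simp
    · intro n x a ha
      replace ha : i (i a) = 0 := ha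
      change i (i (ι κ n x * a)) = 0
      have h0 : i (i (ι κ n x)) = 0 := by
        rw [i_ι]
        cases n with
        | zero => simp [iGen]
        | succ n => exact i_genBar _ _
      rw [i_mul, map_add, i_mul, i_mul, i_parity, h0, ha]
      simp
  exact DFunLike.congr_fun this a

/-- The component of degree `n - 1`. -/
noncomputable def prevGrading : ℕ → Submodule κ (LoopAlg κ V)
  | 0 => ⊥
  | n + 1 => grading κ (LoopGen V) n

theorem prev_mul_mem {m n : ℕ} {a b : LoopAlg κ V} (ha : a ∈ prevGrading (κ := κ) (V := V) m)
    (hb : b ∈ grading κ (LoopGen V) n) : a * b ∈ prevGrading (κ := κ) (V := V) (m + n) := by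
  cases m with
  | zero =>
    obtain rfl : a = 0 := ha
    simp
  | succ m =>
    rw [show m + 1 + n = (m + n) + 1 by ring]
    exact SetLike.GradedMul.mul_mem (A := grading κ (LoopGen V)) (i := m) (j := n) ha hb

theorem mul_prev_mem {m n : ℕ} {a b : LoopAlg κ V} (ha : a ∈ grading κ (LoopGen V) m)
    (hb : b ∈ prevGrading (κ := κ) (V := V) n) : a * b ∈ prevGrading (κ := κ) (V := V) (m + n) := by
  cases n with
  | zero =>
    obtain rfl : b = 0 := hb
    simp
  | succ n =>
    exact SetLike.GradedMul.mul_mem (A := grading κ (LoopGen V)) (i := m) (j := n) ha hb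

theorem i_mem_prev {n : ℕ} {a : LoopAlg κ V} (ha : a ∈ grading κ (LoopGen V) n) :
    i a ∈ prevGrading (κ := κ) (V := V) n := by
  induction ha using Submodule.span_induction with
  | mem a ha =>
    obtain ⟨l, rfl, rfl⟩ := ha
    induction l with
    | nil => simp
    | cons s l ih =>
      simp only [List.map_cons, List.prod_cons, List.sum_cons]
      rw [i_mul, parity_ι, i_ι]
      refine add_mem (prev_mul_mem ?_ (prod_mem l)) (mul_prev_mem (sign_mul_mem (ι_mem _ _)) ih)
      obtain ⟨n, x⟩ := s
      cases n with
      | zero => simp [iGen]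
      | succ n => exact genBar_mem _ _
  | zero => simp
  | add a b _ _ ha hb => rw [map_add]; exact add_mem ha hb
  | smul c a _ ha => rw [map_smul]; exact Submodule.smul_mem _ _ ha

@[simp] theorem incl_ι (n : ℕ) (x : V n) : incl (ι κ n x) = gen κ n x := lift_ι _ _ _ _

@[simp] theorem proj_ι (n : ℕ) (x : LoopGen V n) : proj (ι κ n x) = ι κ n x.1 := lift_ι _ _ _ _

theorem incl_mem {n : ℕ} {a : FreeCGA κ V} (ha : a ∈ grading κ V n) :
    incl a ∈ grading κ (LoopGen V) n := by
  induction ha using Submodule.span_induction with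
  | mem a ha =>
    obtain ⟨l, rfl, rfl⟩ := ha
    induction l with
    | nil => simpa using SetLike.GradedOne.one_mem (A := grading κ (LoopGen V))
    | cons s l ih =>
      simp only [List.map_cons, List.prod_cons, List.sum_cons, map_mul]
      refine SetLike.GradedMul.mul_mem ?_ ih
      rw [incl_ι]
      exact gen_mem _ _
  | zero => simp
  | add a b _ _ ha hb => rw [map_add]; exact add_mem ha hb
  | smul c a _ ha => rw [map_smul]; exact Submodule.smul_mem _ _ ha

theorem proj_mem {n : ℕ} {a : LoopAlg κ V} (ha : a ∈ grading κ (LoopGen V) n) :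
    proj a ∈ grading κ V n := by
  induction ha using Submodule.span_induction with
  | mem a ha =>
    obtain ⟨l, rfl, rfl⟩ := ha
    induction l with
    | nil => simpa using SetLike.GradedOne.one_mem (A := grading κ V)
    | cons s l ih =>
      simp only [List.map_cons, List.prod_cons, List.sum_cons, map_mul]
      refine SetLike.GradedMul.mul_mem ?_ ih
      rw [proj_ι]
      exact ι_mem _ _
  | zero => simp
  | add a b _ _ ha hb => rw [map_add]; exact add_mem ha hb
  | smul c a _ ha => rw [map_smul]; exact Submodule.smul_mem _ _ ha

theorem incl_parity (a : FreeCGA κ V) : incl (parity a) = parity (incl a) := by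
  have : incl.comp parity = parity.comp (incl (κ := κ) (V := V)) := by
    apply algHom_ext
    intro n x
    change incl (parity (ι κ n x)) = parity (incl (ι κ n x))
    rw [parity_ι, map_mul, incl_ι, parity_mem (gen_mem n x)]
    simp
  exact DFunLike.congr_fun this a

theorem proj_parity (a : LoopAlg κ V) : proj (parity a) = parity (proj a) := by
  have : proj.comp parity = parity.comp (proj (κ := κ) (V := V)) := by
    apply algHom_ext
    intro n x
    change proj (parity (ι κ n x)) = parity (proj (ι κ n x))
    rw [parity_ι, map_mul, proj_ι, parity_ι]
    simp
  exact DFunLike.congr_fun this a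

theorem proj_genBar (n : ℕ) (v : V (n + 1)) : proj (genBar κ n v) = 0 := by
  rw [genBar, LinearMap.comp_apply, proj_ι]
  simp

theorem proj_gen (n : ℕ) (v : V n) : proj (gen κ n v) = ι κ n v := by
  rw [gen, LinearMap.comp_apply, proj_ι]
  simp

theorem proj_i (a : LoopAlg κ V) : proj (i a) = 0 := by
  have : proj.toLinearMap ∘ₗ i = (0 : LoopAlg κ V →ₗ[κ] FreeCGA κ V) := by
    apply linearMap_ext
    · simp
    · intro n x a ha
      replace ha : proj (i a) = 0 := ha
      change proj (i (ι κ n x * a)) = 0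
      have h0 : proj (i (ι κ n x)) = 0 := by
        rw [i_ι]
        cases n with
        | zero => simp [iGen]
        | succ n => exact proj_genBar _ _
      rw [i_mul, map_add, map_mul, map_mul, h0, ha]
      simp
  exact DFunLike.congr_fun this a

theorem proj_incl (a : FreeCGA κ V) : proj (incl a) = a := by
  have : proj.comp incl = AlgHom.id κ (FreeCGA κ V) := by
    apply algHom_ext
    intro n x
    change proj (incl (ι κ n x)) = ι κ n x
    rw [incl_ι, proj_gen]
  exact DFunLike.congr_fun this a

variable (d : ExteriorDifferential (grading κ V))

theorem d_one : d.d 1 = 0 := by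
  have := d.leibniz 0 1 (SetLike.GradedOne.one_mem) 1
  simpa using this

theorem d_ι_mul (n : ℕ) (x : V n) (a : FreeCGA κ V) :
    d.d (ι κ n x * a) = d.d (ι κ n x) * a + parity (ι κ n x) * d.d a := by
  rw [d.leibniz n _ (ι_mem n x), parity_ι, mul_assoc]

/-- `δ_V` on generators: `v ↦ d v`, `v̄ ↦ - i^V(d v)`. -/
noncomputable def δGen (n : ℕ) : LoopGen V n →ₗ[κ] LoopAlg κ V :=
  (incl.toLinearMap ∘ₗ d.d ∘ₗ ι κ n).coprod
    (-(i ∘ₗ incl.toLinearMap ∘ₗ d.d ∘ₗ ι κ (n + 1)))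

theorem δGen_mem (n : ℕ) (x : LoopGen V n) : δGen d n x ∈ grading κ (LoopGen V) (n + 1) := by
  rw [δGen, LinearMap.coprod_apply]
  refine add_mem (incl_mem (d.d_mem n _ (ι_mem _ _))) (neg_mem ?_)
  exact i_mem_prev (incl_mem (d.d_mem (n + 1) _ (ι_mem _ _)))

/-- The exterior differential `δ_V` of `Λ[V ⊕ V̄]`: the derivation of degree `+1` with
`δ_V(v) = d v` and `δ_V(v̄) = - i^V(d v)`. -/
noncomputable def δ : LoopAlg κ V →ₗ[κ] LoopAlg κ V :=
  deriv (δGen d) fun i _ x y => odd_comm (n := i + 1) ⟨i + 1, rfl⟩ (δGen_mem d i x) y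

@[simp] theorem δ_ι (n : ℕ) (x : LoopGen V n) : δ d (ι κ n x) = δGen d n x := deriv_ι _ _ _ _

@[simp] theorem δ_one : δ d (1 : LoopAlg κ V) = 0 := deriv_one _ _

theorem δ_mul (a b : LoopAlg κ V) : δ d (a * b) = δ d a * b + parity a * δ d b :=
  deriv_mul _ _ _ _

theorem δ_gen (n : ℕ) (v : V n) : δ d (gen κ n v) = incl (d.d (ι κ n v)) := by
  rw [gen, LinearMap.comp_apply, δ_ι]; simp [δGen]

theorem δ_genBar (n : ℕ) (v : V (n + 1)) :
    δ d (genBar κ n v) = -i (incl (d.d (ι κ (n + 1) v))) := by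
  rw [genBar, LinearMap.comp_apply, δ_ι]; simp [δGen]

theorem δ_parity (a : LoopAlg κ V) : δ d (parity a) = -parity (δ d a) := by
  refine deriv_parity _ _ ?_ a
  intro n x
  rw [parity_mem (δGen_mem d n x), pow_succ]; simp

theorem δ_mem {n : ℕ} {a : LoopAlg κ V} (ha : a ∈ grading κ (LoopGen V) n) :
    δ d a ∈ grading κ (LoopGen V) (n + 1) := by
  induction ha using Submodule.span_induction with
  | mem a ha =>
    obtain ⟨l, rfl, rfl⟩ := ha
    induction l with
    | nil => simp
    | cons s l ih =>
      simp only [List.map_cons, List.prod_cons, List.sum_cons]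
      rw [δ_mul, parity_ι, δ_ι]
      exact add_mem (mul_mem_of_eq (by ring) (δGen_mem d _ _) (prod_mem l))
        (mul_mem_of_eq (by ring) (sign_mul_mem (ι_mem _ _)) ih)
  | zero => simp
  | add a b _ _ ha hb => rw [map_add]; exact add_mem ha hb
  | smul c a _ ha => rw [map_smul]; exact Submodule.smul_mem _ _ ha

theorem δ_incl (a : FreeCGA κ V) : δ d (incl a) = incl (d.d a) := by
  have : δ d ∘ₗ incl.toLinearMap = incl.toLinearMap ∘ₗ d.d := by
    apply linearMap_ext
    · simp [d_one]
    · intro n x a ha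
      replace ha : δ d (incl a) = incl (d.d a) := ha
      change δ d (incl (ι κ n x * a)) = incl (d.d (ι κ n x * a))
      have h0 : δ d (incl (ι κ n x)) = incl (d.d (ι κ n x)) := by
        rw [incl_ι, δ_gen]
      rw [d_ι_mul, map_mul, δ_mul, h0, ha, map_add, map_mul, map_mul, incl_parity]
  exact DFunLike.congr_fun this a

theorem i_δ [Subsingleton (V 0)] (a : LoopAlg κ V) : i (δ d a) + δ d (i a) = 0 := by
  have : i ∘ₗ δ d + δ d ∘ₗ i = 0 := by
    apply linearMap_ext
    · simp
    · intro n x a ha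
      replace ha : i (δ d a) + δ d (i a) = 0 := ha
      change i (δ d (ι κ n x * a)) + δ d (i (ι κ n x * a)) = 0
      have h0 : i (δ d (ι κ n x)) + δ d (i (ι κ n x)) = 0 := by
        rw [ι_eq]
        simp only [map_add, δ_gen, δ_genBar, map_neg, i_i, i_genBar]
        cases n with
        | zero =>
          have : x.1 = 0 := Subsingleton.elim _ _
          simp [this]
        | succ n => simp [δ_genBar]
      rw [δ_mul, i_mul]
      simp only [map_add, i_mul, δ_mul, i_parity, δ_parity, parity_parity]
      calc _ = (i (δ d (ι κ n x)) + δ d (i (ι κ n x))) * a +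
            ι κ n x * (i (δ d a) + δ d (i a)) := by noncomm_ring
        _ = 0 := by rw [h0, ha]; simp
  exact DFunLike.congr_fun this a

theorem δ_δ [Subsingleton (V 0)] (a : LoopAlg κ V) : δ d (δ d a) = 0 := by
  have : δ d ∘ₗ δ d = 0 := by
    apply linearMap_ext
    · simp
    · intro n x a ha
      replace ha : δ d (δ d a) = 0 := ha
      change δ d (δ d (ι κ n x * a)) = 0
      have h0 : δ d (δ d (ι κ n x)) = 0 := by
        rw [ι_eq]
        simp only [map_add, δ_gen, δ_genBar, map_neg, δ_incl, d.d_d, map_zero, zero_add]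
        have := i_δ d (incl (d.d (ι κ (n + 1) x.2)))
        rw [δ_incl, d.d_d] at this
        simpa using this
      rw [δ_mul, map_add, δ_mul, δ_mul, δ_parity, h0, ha]
      simp
  exact DFunLike.congr_fun this a

theorem proj_δ (a : LoopAlg κ V) : proj (δ d a) = d.d (proj a) := by
  have : proj.toLinearMap ∘ₗ δ d = d.d ∘ₗ proj.toLinearMap := by
    apply linearMap_ext
    · simp [d_one]
    · intro n x a ha
      replace ha : proj (δ d a) = d.d (proj a) := ha
      change proj (δ d (ι κ n x * a)) = d.d (proj (ι κ n x * a))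
      have h0 : proj (δ d (ι κ n x)) = d.d (proj (ι κ n x)) := by
        rw [ι_eq]
        simp [δ_gen, δ_genBar, proj_i, proj_incl, proj_gen, proj_genBar]
      have h1 : proj (ι κ n x) = ι κ n x.1 := proj_ι n x
      rw [δ_mul, map_add, map_mul, map_mul, map_mul, proj_parity, h0, ha, h1, d_ι_mul]
  exact DFunLike.congr_fun this a

/-- The free loop mixed complex `(Λ[V ⊕ V̄], δ_V, i^V)` of a free connected CDGA `(Λ[V], d)`. -/
noncomputable def mixed [Subsingleton (V 0)] : MixedComplex.{u, max u v} κ where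
  C n := grading κ (LoopGen V) n
  δ n := (δ d).restrict fun _ ha => δ_mem d ha
  β n := (i (κ := κ) (V := V)).restrict (p := grading κ (LoopGen V) (n + 1))
    (q := grading κ (LoopGen V) n) fun _ ha => i_mem_prev (n := n + 1) ha
  δ_δ n x := Subtype.ext (δ_δ d x.1)
  β_β n x := Subtype.ext (i_i x.1)
  β_δ_zero x := by
    apply Subtype.ext
    change i (δ d x.1) = 0
    have h : i x.1 = 0 := i_mem_prev (n := 0) x.2
    have := i_δ d x.1
    rw [h, map_zero, add_zero] at this
    exact this
  β_δ n x := Subtype.ext (i_δ d x.1)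

/-- The projection `(Λ[V ⊕ V̄], δ_V, i^V) → (Λ[V], d, 0)` on the component of weight zero. -/
noncomputable def projMixed [Subsingleton (V 0)] : MixedComplex.Hom (mixed d) d.mixed where
  f _ := (proj (κ := κ) (V := V)).toLinearMap.restrict fun _ ha => proj_mem ha
  comm_δ _ x := Subtype.ext (proj_δ d x.1)
  comm_β _ x := Subtype.ext (proj_i x.1)

end Loop

end Loop

/-! ## The functors `K`, `CH`, `SH` -/

section Functors

variable (κ : Type u) [Field κ]

/-- The mixed complex `(κ, 0, 0)`, with `κ = Λ[0]` in degree zero. It is also the free loop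
mixed complex of `Λ[0] = κ`. -/
def point : MixedComplex.{u, u} κ where
  C n := (if n = 0 then ⊤ else ⊥ : Submodule κ κ)
  δ _ := 0
  β _ := 0
  δ_δ _ _ := rfl
  β_β _ _ := rfl
  β_δ_zero _ := rfl
  β_δ _ _ := add_zero _

variable {κ} {V : ℕ → Type v} [∀ n, AddCommGroup (V n)] [∀ n, Module κ (V n)]

open FreeCGA

theorem algebraMap_mem_grading {W : ℕ → Type v} [∀ n, AddCommGroup (W n)] [∀ n, Module κ (W n)]
    (n : ℕ) (c : κ) (hc : c ∈ (if n = 0 then ⊤ else ⊥ : Submodule κ κ)) :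
    Algebra.linearMap κ (FreeCGA κ W) c ∈ grading κ W n := by
  split_ifs at hc with h
  · subst h
    exact SetLike.algebraMap_mem_graded (grading κ W) c
  · obtain rfl : c = 0 := hc
    simp

/-- The morphism `κ → (Λ[V], d)` induced by the unit. -/
noncomputable def unitHom (d : ExteriorDifferential (grading κ V)) :
    MixedComplex.Hom (point κ) d.mixed where
  f n := (Algebra.linearMap κ (FreeCGA κ V)).restrict (algebraMap_mem_grading n)
  comm_δ n x := by
    apply Subtype.ext
    change algebraMap κ (FreeCGA κ V) 0 = d.d (algebraMap κ (FreeCGA κ V) x.1)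
    rw [Algebra.algebraMap_eq_smul_one x.1, map_smul, Loop.d_one]; simp
  comm_β n x := map_zero _

/-- `K^r(Λ[V], d) = ∏ H^n(Λ[V], d)`, over the `n ≥ 0` with `n ≡ r mod 2`. -/
abbrev K (d : ExteriorDifferential (grading κ V)) (r : ℤ) : Type (max u v) := d.mixed.prodH r

/-- The reduced group `K̄^r = coker (K^r(κ) → K^r(Λ[V], d))`. -/
abbrev redK (d : ExteriorDifferential (grading κ V)) (r : ℤ) : Type (max u v) :=
  K d r ⧸ LinearMap.range ((unitHom d).mapProdH r)

variable [Subsingleton (V 0)]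

/-- The morphism `κ → (Λ[V ⊕ V̄], δ_V, i^V)` induced by the unit. -/
noncomputable def unitLoop (d : ExteriorDifferential (grading κ V)) :
    MixedComplex.Hom (point κ) (Loop.mixed d) where
  f n := (Algebra.linearMap κ (LoopAlg κ V)).restrict (algebraMap_mem_grading n)
  comm_δ n x := by
    apply Subtype.ext
    change algebraMap κ (LoopAlg κ V) 0 = Loop.δ d (algebraMap κ (LoopAlg κ V) x.1)
    rw [Algebra.algebraMap_eq_smul_one x.1, map_smul, Loop.δ_one]; simp
  comm_β n x := by
    apply Subtype.ext
    change algebraMap κ (LoopAlg κ V) 0 = Loop.i (algebraMap κ (LoopAlg κ V) x.1)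
    rw [Algebra.algebraMap_eq_smul_one x.1, map_smul, Loop.i_one]; simp

variable (d : ExteriorDifferential (grading κ V)) (r : ℤ)

/-- `CH^r(Λ[V], d) = ⁺H^r(Λ[V ⊕ V̄], δ_V, i^V)`. -/
abbrev CH : Type (max u v) := (Loop.mixed d).plus.H r

/-- The reduced group `C̄H^r = coker (CH^r(κ) → CH^r(Λ[V], d))`. -/
abbrev redCH : Type (max u v) := CH d r ⧸ LinearMap.range ((unitLoop d).plus.map r)

/-- The composition `⁺C^{*-2}(Λ[V ⊕ V̄], δ_V, i^V) → ℙC^*(Λ[V ⊕ V̄], δ_V, i^V) → ℙC^*(Λ[V], d, 0)`. -/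
noncomputable def I : CochainCx.Hom ((Loop.mixed d).plus.reindex (-2)) d.mixed.periodic :=
  (Loop.projMixed d).periodic.comp (Loop.mixed d).incl

/-- `SH^r(Λ[V], d)`, the cohomology of the mapping cone of `I`. -/
abbrev SH : Type (max u v) := (CochainCx.cone (I d)).H r

/-- `J^r : K^r → SH^r`, induced by the inclusion of `ℙC^*(Λ[V], d, 0)` in the mapping cone and the
identification `H^r(ℙC(Λ[V], d, 0)) = K^r`. -/
noncomputable def J : K d r →ₗ[κ] SH d r :=
  (CochainCx.coneInl (I d)).map r ∘ₗ (d.mixed.periodicEquiv d.mixed_β r).symm.toLinearMap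

/-- `B^r : SH^r → CH^{r-1}`, induced by the projection of the mapping cone,
`ℙC^r ⊕ ⁺C^{r-1} → ⁺C^{r-1}`. -/
noncomputable def B : SH d r →ₗ[κ] CH d (r - 1) :=
  CochainCx.cohMap (C := CochainCx.cone (I d)) (C' := (Loop.mixed d).plus)
    (LinearMap.snd κ d.mixed.periodic.T (Loop.mixed d).plus.T)
    (by
      rintro ⟨y, z⟩ ⟨⟨_, hz⟩, hD⟩
      refine ⟨?_, ?_⟩
      · change z ∈ (Loop.mixed d).plus.deg (r + 1 + -2) at hz
        rwa [show r + 1 + -2 = r - 1 by ring] at hz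
      · have h : -((Loop.mixed d).plus.D z) = 0 := congrArg Prod.snd hD
        exact neg_eq_zero.1 h)
    (by
      rintro _ ⟨⟨y, z⟩, ⟨_, hz⟩, rfl⟩
      change z ∈ (Loop.mixed d).plus.deg (r - 1 + 1 + -2) at hz
      rw [show r - 1 + 1 + -2 = r - 1 - 1 by ring] at hz
      exact ⟨-z, neg_mem hz, map_neg _ _⟩)

/-- The composition `SH^r → CH^{r-1} → C̄H^{r-1}`. -/
noncomputable def redB : SH d r →ₗ[κ] redCH d (r - 1) := Submodule.mkQ _ ∘ₗ B d r

end Functors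

end CyclicCDGA

/-!
Write `L = Λ[V ⊕ V̄]`. The long exact sequence of the mapping cone of `I` reduces the short exact
sequence to one assertion: for `r ≥ 1` the image of `I : CH^{r-2} → K^r` is the image of `K^r(κ)`,
the multiples of the unit if `r` is even and `0` if `r` is odd.

The map `I` factors through the cohomology of `ℙC(L, δ, i)`, so it suffices that the latter is that
of a point (`exists_eq_totD_add_unit`). The reason is a Poincaré lemma: `(L, i)` is an algebraic
de Rham complex, the derivation `h` with `h(v̄) = v`, `h(v) = 0` satisfies `i h + h i = k` on
products of `k` generators, and in characteristic `0` one divides by `k`, so that `(L, i)` is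
contractible onto the constants (`Loop.i_contraction`). As `ℙC` consists of infinite products,
`(δ + i) η = ω - const` can then be solved for a cocycle `ω` from the lowest degree upwards
(`MixedComplex.totD_primitive`).

Conversely, the unit of `CH^{r-2}` exists because `r - 2 ≥ 0` when `r ≥ 1` is even, and `I` maps it
to the unit of `K^r`, which is not a coboundary because nothing maps to degree `0`. Diagram chases
in the cone give `range_unit_le_ker_J`, `ker_J_le_range_unit`, `exists_J_eq_of_redB_eq_zero` and
`redB_surjective`.
-/

namespace CyclicCDGA

universe u v

/-! ### Word length in the free commutative graded algebra -/

namespace FreeCGA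

variable {κ : Type u} [Field κ] {W : ℕ → Type v} [∀ n, AddCommGroup (W n)] [∀ n, Module κ (W n)]

variable (κ W) in
/-- The span of the products of `k` homogeneous generators: the component of word length `k`. -/
noncomputable def wordSpan (k : ℕ) : Submodule κ (FreeCGA κ W) :=
  Submodule.span κ {a | ∃ l : List (Σ n, W n),
    l.length = k ∧ (l.map fun s => ι κ s.1 s.2).prod = a}

theorem prod_mem_wordSpan (l : List (Σ n, W n)) :
    (l.map fun s => ι κ s.1 s.2).prod ∈ wordSpan κ W l.length :=
  Submodule.subset_span ⟨l, rfl, rfl⟩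

theorem ι_mul_mem_wordSpan {k n : ℕ} (x : W n) {a : FreeCGA κ W} (ha : a ∈ wordSpan κ W k) :
    ι κ n x * a ∈ wordSpan κ W (k + 1) := by
  induction ha using Submodule.span_induction with
  | mem a ha =>
    obtain ⟨l, rfl, rfl⟩ := ha
    simpa using prod_mem_wordSpan (κ := κ) (⟨n, x⟩ :: l)
  | zero => simp
  | add a b _ _ ha hb => rw [mul_add]; exact add_mem ha hb
  | smul c a _ ha => rw [mul_smul_comm]; exact Submodule.smul_mem _ _ ha

/-- Linear maps that agree on products of generators are equal. -/
theorem linearMap_ext_prod {B : Type*} [AddCommGroup B] [Module κ B] {f g : FreeCGA κ W →ₗ[κ] B}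
    (h : ∀ l : List (Σ n, W n), f (l.map fun s => ι κ s.1 s.2).prod =
      g (l.map fun s => ι κ s.1 s.2).prod) : f = g := by
  ext a
  induction a using DirectSum.Decomposition.inductionOn (grading κ W) with
  | zero => simp
  | homogeneous a =>
    obtain ⟨a, ha⟩ := a
    change f a = g a
    induction ha using Submodule.span_induction with
    | mem x hx => obtain ⟨l, rfl, rfl⟩ := hx; exact h l
    | zero => simp
    | add x y _ _ hx hy => simp [hx, hy]
    | smul c x _ hx => simp [hx]
  | add a b ha hb => simp [ha, hb]

/-- The homomorphism `Λ[W] → Λ[W][T]` that multiplies each generator by `T`; the coefficient of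
`T ^ k` is the component of word length `k`. -/
noncomputable def wordPoly : FreeCGA κ W →ₐ[κ] Polynomial (FreeCGA κ W) :=
  lift (fun n =>
    { toFun := fun x => Polynomial.monomial 1 (ι κ n x)
      map_add' := fun x y => by simp
      map_smul' := fun c x => by rw [map_smul, RingHom.id_apply, Polynomial.smul_monomial] }) (by
    intro i j x y
    simp only [LinearMap.coe_mk, AddHom.coe_mk, Polynomial.monomial_mul_monomial]
    rw [ι_comm x y]
    rcases Nat.even_or_odd (i * j) with h | h <;> simp [h.neg_one_pow])

theorem wordPoly_prod (l : List (Σ n, W n)) :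
    wordPoly (l.map fun s => ι κ s.1 s.2).prod =
      Polynomial.monomial l.length (l.map fun s => ι κ s.1 s.2).prod := by
  induction l with
  | nil => simp
  | cons s l ih =>
    have hs : wordPoly (ι κ s.1 s.2) = Polynomial.monomial 1 (ι κ s.1 s.2) := by
      rw [wordPoly, lift_ι]; rfl
    simp only [List.map_cons, List.prod_cons, map_mul, ih, hs, List.length_cons,
      Polynomial.monomial_mul_monomial, add_comm]

/-- The operator that divides an element of word length `k` by `k`. It vanishes on the elements of
word length `0`, since `0⁻¹ = 0`. -/
noncomputable def divLength : FreeCGA κ W →ₗ[κ] FreeCGA κ W where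
  toFun a := (wordPoly a).sum fun k b => (k : κ)⁻¹ • b
  map_add' a b := by
    rw [map_add]
    exact Polynomial.sum_add_index _ _ _ (by simp) (by simp)
  map_smul' c a := by
    rw [map_smul, Polynomial.sum_smul_index' _ _ _ (by simp), Polynomial.sum, Polynomial.sum,
      RingHom.id_apply, Finset.smul_sum]
    exact Finset.sum_congr rfl fun k _ => smul_comm _ _ _

theorem divLength_of_mem {k : ℕ} {a : FreeCGA κ W} (ha : a ∈ wordSpan κ W k) :
    divLength a = (k : κ)⁻¹ • a := by
  induction ha using Submodule.span_induction with
  | mem a ha =>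
    obtain ⟨l, rfl, rfl⟩ := ha
    change (wordPoly _).sum _ = _
    rw [wordPoly_prod, Polynomial.sum_monomial_index _ _ (by simp)]
  | zero => simp
  | add a b _ _ ha hb => rw [map_add, ha, hb, smul_add]
  | smul c a _ ha => rw [map_smul, ha, smul_comm]

theorem divLength_mem {n : ℕ} {a : FreeCGA κ W} (ha : a ∈ grading κ W n) :
    divLength a ∈ grading κ W n := by
  induction ha using Submodule.span_induction with
  | mem a ha =>
    obtain ⟨l, rfl, rfl⟩ := ha
    rw [divLength_of_mem (prod_mem_wordSpan l)]
    exact Submodule.smul_mem _ _ (prod_mem l)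
  | zero => simp
  | add a b _ _ ha hb => rw [map_add]; exact add_mem ha hb
  | smul c a _ ha => rw [map_smul]; exact Submodule.smul_mem _ _ ha

variable (κ W) in
/-- The augmentation `Λ[W] → κ`, which vanishes on the generators. -/
noncomputable def aug : FreeCGA κ W →ₐ[κ] κ := lift (fun _ => 0) (by simp)

theorem algebraMap_injective : Function.Injective (algebraMap κ (FreeCGA κ W)) :=
  Function.LeftInverse.injective (g := aug κ W) fun c => by simp

theorem aug_prod (l : List (Σ n, W n)) (hl : l ≠ []) :
    aug κ W (l.map fun s => ι κ s.1 s.2).prod = 0 := by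
  cases l with
  | nil => exact absurd rfl hl
  | cons s l =>
    have hs : aug κ W (ι κ s.1 s.2) = 0 := by rw [aug, lift_ι]; rfl
    simp [hs]

theorem aug_of_mem {n : ℕ} {a : FreeCGA κ W} (ha : a ∈ grading κ W n) (hn : n ≠ 0) :
    aug κ W a = 0 := by
  induction ha using Submodule.span_induction with
  | mem a ha =>
    obtain ⟨l, rfl, rfl⟩ := ha
    exact aug_prod l (by rintro rfl; simp at hn)
  | zero => simp
  | add a b _ _ ha hb => rw [map_add, ha, hb, add_zero]
  | smul c a _ ha => rw [map_smul, ha, smul_zero]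

end FreeCGA

/-! ### The Poincaré lemma for the interior differential -/

namespace Loop

open FreeCGA

variable {κ : Type u} [Field κ] {V : ℕ → Type v} [∀ n, AddCommGroup (V n)]
  [∀ n, Module κ (V n)]

/-- The operator `h` on generators: `v ↦ 0`, `v̄ ↦ v`. -/
noncomputable def unbarGen (n : ℕ) : LoopGen V n →ₗ[κ] LoopAlg κ V :=
  gen κ (n + 1) ∘ₗ LinearMap.snd κ (V n) (V (n + 1))

theorem unbarGen_mem (n : ℕ) (x : LoopGen V n) :
    unbarGen n x ∈ grading κ (LoopGen V) (n + 1) := gen_mem _ _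

/-- The derivation `h` of degree `+1` of `Λ[V ⊕ V̄]` with `h(v) = 0` and `h(v̄) = v`. -/
noncomputable def unbar : LoopAlg κ V →ₗ[κ] LoopAlg κ V :=
  deriv unbarGen fun i _ x y => odd_comm (n := i + 1) ⟨i + 1, rfl⟩ (unbarGen_mem i x) y

@[simp] theorem unbar_ι (n : ℕ) (x : LoopGen V n) : unbar (ι κ n x) = gen κ (n + 1) x.2 :=
  deriv_ι _ _ _ _

@[simp] theorem unbar_one : unbar (1 : LoopAlg κ V) = 0 := deriv_one _ _

theorem unbar_mul (a b : LoopAlg κ V) : unbar (a * b) = unbar a * b + parity a * unbar b :=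
  deriv_mul _ _ _ _

theorem unbar_parity (a : LoopAlg κ V) : unbar (parity a) = -parity (unbar a) := by
  refine deriv_parity _ _ ?_ a
  intro n x
  rw [parity_mem (unbarGen_mem n x), pow_succ]; simp

theorem unbar_mem {n : ℕ} {a : LoopAlg κ V} (ha : a ∈ grading κ (LoopGen V) n) :
    unbar a ∈ grading κ (LoopGen V) (n + 1) := by
  induction ha using Submodule.span_induction with
  | mem a ha =>
    obtain ⟨l, rfl, rfl⟩ := ha
    induction l with
    | nil => simp
    | cons s l ih =>
      simp only [List.map_cons, List.prod_cons, List.sum_cons]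
      rw [unbar_mul, parity_ι, unbar_ι]
      exact add_mem (mul_mem_of_eq (by ring) (gen_mem _ _) (prod_mem l))
        (mul_mem_of_eq (by ring) (sign_mul_mem (ι_mem _ _)) ih)
  | zero => simp
  | add a b _ _ ha hb => rw [map_add]; exact add_mem ha hb
  | smul c a _ ha => rw [map_smul]; exact Submodule.smul_mem _ _ ha

theorem i_unbar_ι [Subsingleton (V 0)] (n : ℕ) (x : LoopGen V n) :
    i (unbar (ι κ n x)) + unbar (i (ι κ n x)) = ι κ n x := by
  have hb : ∀ m (w : V (m + 1)), unbar (genBar κ m w) = gen κ (m + 1) w := fun m w => by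
    rw [genBar, LinearMap.comp_apply, unbar_ι]; rfl
  rw [unbar_ι, i_gen, ι_eq, map_add, i_genBar, add_zero, add_comm]
  congr 1
  cases n with
  | zero =>
    have : x.1 = 0 := Subsingleton.elim _ _
    simp [this]
  | succ n => rw [i_gen, hb]

theorem i_unbar_mul (a b : LoopAlg κ V) :
    i (unbar (a * b)) + unbar (i (a * b)) =
      (i (unbar a) + unbar (i a)) * b + a * (i (unbar b) + unbar (i b)) := by
  simp only [unbar_mul, i_mul, map_add, i_parity, unbar_parity, parity_parity]
  noncomm_ring

/-- The derivation `i h + h i` of degree `0` is the identity on generators, so that it multiplies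
a product of `k` generators by `k`. -/
theorem i_unbar_prod [Subsingleton (V 0)] (l : List (Σ n, LoopGen V n)) :
    i (unbar (l.map fun s => ι κ s.1 s.2).prod) + unbar (i (l.map fun s => ι κ s.1 s.2).prod) =
      (l.length : κ) • (l.map fun s => ι κ s.1 s.2).prod := by
  induction l with
  | nil => simp
  | cons s l ih =>
    simp only [List.map_cons, List.prod_cons, List.length_cons]
    rw [i_unbar_mul, i_unbar_ι, ih, mul_smul_comm, Nat.cast_succ, add_smul, one_smul, add_comm]

theorem i_mem_wordSpan (l : List (Σ n, LoopGen V n)) :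
    i (l.map fun s => ι κ s.1 s.2).prod ∈ wordSpan κ (LoopGen V) l.length := by
  induction l with
  | nil => simp
  | cons s l ih =>
    simp only [List.map_cons, List.prod_cons, List.length_cons]
    rw [i_mul, parity_ι, i_ι, mul_assoc]
    refine add_mem ?_ ?_
    · obtain ⟨n, x⟩ := s
      cases n with
      | zero => simp [iGen]
      | succ n => exact ι_mul_mem_wordSpan _ (prod_mem_wordSpan l)
    · have := ι_mul_mem_wordSpan s.2 ih
      rcases neg_one_pow_eq_or (LoopAlg κ V) s.1 with h | h <;> simpa [h] using this

theorem divLength_i (a : LoopAlg κ V) : divLength (i a) = i (divLength a) := by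
  have : divLength ∘ₗ i = i ∘ₗ divLength (κ := κ) (W := LoopGen V) := by
    refine linearMap_ext_prod fun l => ?_
    simp only [LinearMap.comp_apply]
    rw [divLength_of_mem (i_mem_wordSpan l), divLength_of_mem (prod_mem_wordSpan l), map_smul]
  exact DFunLike.congr_fun this a

/-- The Poincaré lemma for `(Λ[V ⊕ V̄], i^V)`: the homotopy `h ∘ divLength` contracts the complex
onto the constants. -/
theorem i_contraction [CharZero κ] [Subsingleton (V 0)] (a : LoopAlg κ V) :
    i (unbar (divLength a)) + unbar (divLength (i a)) +
      algebraMap κ (LoopAlg κ V) (aug κ (LoopGen V) a) = a := by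
  have : i ∘ₗ unbar ∘ₗ divLength + unbar ∘ₗ i ∘ₗ divLength +
      Algebra.linearMap κ (LoopAlg κ V) ∘ₗ (aug κ (LoopGen V)).toLinearMap = LinearMap.id := by
    refine linearMap_ext_prod fun l => ?_
    simp only [LinearMap.add_apply, LinearMap.comp_apply, Algebra.linearMap_apply,
      AlgHom.toLinearMap_apply, LinearMap.id_apply]
    rw [divLength_of_mem (prod_mem_wordSpan l), map_smul, map_smul, map_smul, map_smul, ← smul_add,
      i_unbar_prod, smul_smul]
    cases l with
    | nil => simp
    | cons s l =>
      rw [aug_prod _ (List.cons_ne_nil _ _), map_zero, add_zero, inv_mul_cancel₀ (by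
        rw [List.length_cons]; exact Nat.cast_ne_zero.2 (Nat.succ_ne_zero _)), one_smul]
  rw [divLength_i]
  exact DFunLike.congr_fun this a

end Loop

/-! ### Cocycles of the periodic complex -/

namespace MixedComplex

variable {κ : Type u} [Field κ]

/-- The solution `η` of `δ η_n + β η_{n+2} = ω_{n+1}` given by a contracting homotopy `h` of `β`,
built from the lowest degree upwards. -/
def primitive (M : MixedComplex.{u, v} κ) (h : ∀ n, M.C n →ₗ[κ] M.C (n + 1)) (ω : ∀ n, M.C n) :
    ∀ n, M.C n
  | 0 => 0
  | 1 => h 0 (ω 0)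
  | n + 2 => h (n + 1) (ω (n + 1) - M.δ n (primitive M h ω n))

variable {M : MixedComplex.{u, v} κ} {h : ∀ n, M.C n →ₗ[κ] M.C (n + 1)}

theorem primitive_mem {ω : ∀ n, M.C n} {r : ℤ} (hω : ω ∈ M.periodic.deg r) :
    M.primitive h ω ∈ M.periodic.deg (r - 1) := by
  have hω : ∀ n : ℕ, ¬ Even (r - n) → ω n = 0 := hω
  change ∀ n : ℕ, ¬ Even (r - 1 - n) → M.primitive h ω n = 0
  intro n
  induction n using Nat.twoStepInduction with
  | zero => intro _; rfl
  | one =>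
    intro hn
    rw [primitive, hω 0 (by rw [Int.even_iff] at hn ⊢; push_cast at *; omega), map_zero]
  | more n ih _ =>
    intro hn
    rw [primitive, hω (n + 1) (by rw [Int.even_iff] at hn ⊢; push_cast at *; omega),
      ih (by rw [Int.even_iff] at hn ⊢; push_cast at *; omega)]
    simp

/-- If `β` has homology concentrated in degree `0`, as witnessed by a contracting homotopy `h`,
and `p` is the resulting projection of `C^0` onto representatives, then each cocycle `ω` of `ℙC` is
cohomologous to `p ω₀`. The primitive may be nonzero in infinitely many degrees, which is why `ℙC`
has to consist of direct products. -/
theorem totD_primitive {p : M.C 0 → M.C 0}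
    (h0 : ∀ x, M.β 0 (h 0 x) + p x = x) (hp : ∀ x, M.δ 0 (p x) = 0)
    (hs : ∀ n x, M.β (n + 1) (h (n + 1) x) + h n (M.β n x) = x)
    {ω : ∀ n, M.C n} (hω : M.totD ω = 0) :
    M.totD (M.primitive h ω) + Pi.single 0 (p (ω 0)) = ω := by
  have hω0 : M.β 0 (ω 1) = 0 := congrFun hω 0
  have hω1 : ∀ n, M.δ n (ω n) + M.β (n + 1) (ω (n + 2)) = 0 := fun n => congrFun hω (n + 1)
  -- once the right-hand side is a `β`-cycle, the homotopy solves the equation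
  have solve : ∀ n, M.β n (ω (n + 1) - M.δ n (M.primitive h ω n)) = 0 →
      M.δ n (M.primitive h ω n) + M.β (n + 1) (M.primitive h ω (n + 2)) = ω (n + 1) := by
    intro n hn
    have := hs n (ω (n + 1) - M.δ n (M.primitive h ω n))
    rw [hn, map_zero, add_zero] at this
    rw [primitive, this]; abel
  have key : ∀ n, M.δ n (M.primitive h ω n) + M.β (n + 1) (M.primitive h ω (n + 2)) =
      ω (n + 1) := by
    intro n
    induction n using Nat.twoStepInduction with
    | zero => apply solve; simp [primitive, hω0]
    | one =>
      apply solve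
      have e1 := M.β_δ 0 (h 0 (ω 0))
      have e2 : M.δ 0 (M.β 0 (h 0 (ω 0))) = M.δ 0 (ω 0) := by
        conv_rhs => rw [← h0 (ω 0), map_add, hp, add_zero]
      rw [e2] at e1
      change M.β 1 (ω 2 - M.δ 1 (h 0 (ω 0))) = 0
      rw [map_sub, eq_neg_of_add_eq_zero_left e1, sub_neg_eq_add, add_comm]
      exact hω1 0
    | more n ih _ =>
      apply solve
      have e1 := M.β_δ (n + 1) (M.primitive h ω (n + 2))
      have e2 : M.δ (n + 1) (M.β (n + 1) (M.primitive h ω (n + 2))) = M.δ (n + 1) (ω (n + 1)) := by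
        rw [← ih, map_add, M.δ_δ, zero_add]
      rw [e2] at e1
      rw [map_sub, eq_neg_of_add_eq_zero_left e1, sub_neg_eq_add]
      exact (add_comm _ _).trans (hω1 (n + 1))
  funext n
  cases n with
  | zero =>
    change M.β 0 (h 0 (ω 0)) + Pi.single 0 (p (ω 0)) 0 = ω 0
    rw [Pi.single_eq_same, h0]
  | succ n =>
    rw [Pi.add_apply, Pi.single_eq_of_ne (Nat.succ_ne_zero n), add_zero]
    exact key n

end MixedComplex

/-! ### The unit -/

section Functors

open FreeCGA

variable {κ : Type u} [Field κ] {V : ℕ → Type v} [∀ n, AddCommGroup (V n)] [∀ n, Module κ (V n)]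

theorem point_eq_zero {n : ℕ} (hn : n ≠ 0) (x : (point κ).C n) : x = 0 := by
  obtain ⟨x, hx⟩ := x
  rw [if_neg hn] at hx
  exact Subtype.ext hx

theorem point_totD (e : ∀ n, (point κ).C n) : (point κ).totD e = 0 := by
  funext n
  cases n with
  | zero => rfl
  | succ n => exact add_zero _

/-- In degrees `r ≥ 1` the complexes `⁺C^{*-2}` and `ℙC` of a point agree. -/
theorem point_mem_plus {r : ℤ} (hr : 1 ≤ r) {e : ∀ n, (point κ).C n}
    (he : e ∈ (point κ).periodic.deg r) : e ∈ (point κ).plus.deg (r - 2) := by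
  intro n hn
  by_cases h : n = 0
  · subst h
    refine he 0 fun h => hn ?_
    rw [Int.even_iff] at h ⊢
    push_cast at *
    omega
  · exact point_eq_zero h _

/-- A unit class that bounds in `ℙC(Λ[V], d, 0)` vanishes: nothing bounds in degree `0`. -/
theorem eq_zero_of_unit_eq_totD (d : ExteriorDifferential (grading κ V)) {e : ∀ n, (point κ).C n}
    {η : ∀ n, d.mixed.C n} (h : (unitHom d).tot e = d.mixed.totD η) : e = 0 := by
  funext n
  cases n with
  | zero =>
    have h0 : (unitHom d).f 0 (e 0) = 0 := congrFun h 0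
    have h1 : algebraMap κ (FreeCGA κ V) (e 0).1 = 0 := congrArg Subtype.val h0
    exact Subtype.ext (algebraMap_injective (h1.trans (map_zero _).symm))
  | succ n => exact point_eq_zero (Nat.succ_ne_zero n) _

variable (d : ExteriorDifferential (grading κ V))

theorem periodicToProd_surjective (r : ℤ) (x : K d r) :
    ∃ (ω : ∀ n, d.mixed.C n) (hω : ω ∈ d.mixed.periodic.Z r),
      d.mixed.periodicToProd d.mixed_β r (Submodule.Quotient.mk ⟨ω, hω⟩) = x := by
  obtain ⟨y, rfl⟩ := (d.mixed.periodicToProd_bijective d.mixed_β r).2 x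
  obtain ⟨⟨ω, hω⟩, rfl⟩ := Submodule.Quotient.mk_surjective _ y
  exact ⟨ω, hω, rfl⟩

theorem unitHom_tot_mem_Z {r : ℤ} {e : ∀ n, (point κ).C n} (he : e ∈ (point κ).periodic.deg r) :
    (unitHom d).tot e ∈ d.mixed.periodic.Z r := by
  refine ⟨(unitHom d).periodic.f_mem _ _ he, ?_⟩
  change d.mixed.totD ((unitHom d).tot e) = 0
  rw [← (unitHom d).tot_comm, point_totD, map_zero]

/-- The classes in `K^r` of the multiples of the unit are those that come from `K^r(κ)`. -/
theorem mem_range_unit_iff (r : ℤ) (x : K d r) :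
    x ∈ LinearMap.range ((unitHom d).mapProdH r) ↔
      ∃ (e : ∀ n, (point κ).C n) (he : e ∈ (point κ).periodic.deg r),
        d.mixed.periodicToProd d.mixed_β r
          (Submodule.Quotient.mk ⟨_, unitHom_tot_mem_Z d he⟩) = x := by
  constructor
  · rintro ⟨p, rfl⟩
    obtain ⟨y, rfl⟩ := ((point κ).periodicToProd_bijective (fun _ => rfl) r).2 p
    obtain ⟨⟨e, he⟩, rfl⟩ := Submodule.Quotient.mk_surjective _ y
    exact ⟨e, he.1, rfl⟩
  · rintro ⟨e, _, rfl⟩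
    exact ⟨fun n => Submodule.Quotient.mk ⟨e n, rfl⟩, rfl⟩

variable [Subsingleton (V 0)]

/-- `I`, whose underlying map is `(projMixed d).tot`, takes the unit to the unit. -/
theorem projMixed_tot_unitLoop (e : ∀ n, (point κ).C n) :
    (Loop.projMixed d).tot ((unitLoop d).tot e) = (unitHom d).tot e := by
  funext n
  apply Subtype.ext
  exact AlgHom.commutes (Loop.proj (κ := κ) (V := V)) (e n).1

theorem totD_unitLoop (e : ∀ n, (point κ).C n) :
    (Loop.mixed d).totD ((unitLoop d).tot e) = 0 := by
  rw [← (unitLoop d).tot_comm, point_totD, map_zero]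

/-! ### The cohomology of the periodic complex -/

/-- The cohomology of `ℙC(Λ[V ⊕ V̄], δ, i)` comes from the unit: each cocycle is the sum of a
constant and a coboundary. -/
theorem exists_eq_totD_add_unit [CharZero κ] {r : ℤ} {ω : ∀ n, (Loop.mixed d).C n}
    (hω : ω ∈ (Loop.mixed d).periodic.Z r) :
    ∃ (η : ∀ n, (Loop.mixed d).C n) (e : ∀ n, (point κ).C n),
      η ∈ (Loop.mixed d).periodic.deg (r - 1) ∧ e ∈ (point κ).periodic.deg r ∧
      ω = (Loop.mixed d).totD η + (unitLoop d).tot e := by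
  let h : ∀ n, (Loop.mixed d).C n →ₗ[κ] (Loop.mixed d).C (n + 1) := fun n =>
    (Loop.unbar ∘ₗ divLength).restrict (p := grading κ (LoopGen V) n)
      (q := grading κ (LoopGen V) (n + 1)) fun _ ha => Loop.unbar_mem (divLength_mem ha)
  let e : ∀ n, (point κ).C n := Pi.single 0 ⟨aug κ (LoopGen V) (ω 0).1, by simp⟩
  let p : (Loop.mixed d).C 0 → (Loop.mixed d).C 0 := fun x =>
    ⟨algebraMap κ _ (aug κ (LoopGen V) x.1), SetLike.algebraMap_mem_graded _ _⟩
  refine ⟨(Loop.mixed d).primitive h ω, e, MixedComplex.primitive_mem hω.1, ?_, ?_⟩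
  · intro n hn
    cases n with
    | zero =>
      have h0 : ω 0 = 0 := hω.1 0 hn
      apply Subtype.ext
      change aug κ (LoopGen V) (ω 0).1 = 0
      rw [h0]
      exact map_zero _
    | succ n => exact point_eq_zero (Nat.succ_ne_zero n) _
  · have hp : (unitLoop d).tot e = Pi.single 0 (p (ω 0)) := by
      funext n
      cases n with
      | zero => rfl
      | succ n =>
        change (unitLoop d).f (n + 1) (e (n + 1)) = 0
        rw [point_eq_zero (Nat.succ_ne_zero n) (e (n + 1)), map_zero]
    rw [hp]
    refine (MixedComplex.totD_primitive ?_ ?_ ?_ hω.2).symm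
    · intro x
      apply Subtype.ext
      have hi : Loop.i x.1 = 0 := Loop.i_mem_prev (n := 0) x.2
      have := Loop.i_contraction x.1
      rwa [hi, map_zero, map_zero, add_zero] at this
    · intro x
      apply Subtype.ext
      change Loop.δ d (algebraMap κ _ (aug κ (LoopGen V) x.1)) = 0
      rw [Algebra.algebraMap_eq_smul_one, map_smul, Loop.δ_one, smul_zero]
    · intro n x
      apply Subtype.ext
      have := Loop.i_contraction x.1
      rwa [aug_of_mem x.2 (Nat.succ_ne_zero n), map_zero, add_zero] at this

/-- The map `I` factors through `ℙC(Λ[V ⊕ V̄], δ, i)`, so that in cohomology its image consists of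
multiples of the unit. -/
theorem exists_I_eq_totD_add_unit [CharZero κ] {r : ℤ} {z : ∀ n, (Loop.mixed d).C n}
    (hz : z ∈ (Loop.mixed d).plus.deg (r - 2)) (hDz : (Loop.mixed d).totD z = 0) :
    ∃ (η : ∀ n, d.mixed.C n) (e : ∀ n, (point κ).C n),
      η ∈ d.mixed.periodic.deg (r - 1) ∧ e ∈ (point κ).periodic.deg r ∧
      (Loop.projMixed d).tot z = d.mixed.totD η + (unitHom d).tot e := by
  obtain ⟨η, e, hη, he, h⟩ :=
    exists_eq_totD_add_unit d (r := r) (ω := z) ⟨(Loop.mixed d).incl.f_mem r z hz, hDz⟩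
  refine ⟨(Loop.projMixed d).tot η, e, (Loop.projMixed d).periodic.f_mem _ _ hη, he, ?_⟩
  rw [h, map_add, projMixed_tot_unitLoop, (Loop.projMixed d).tot_comm]

/-! ### The exact sequence -/

theorem J_periodicToProd (r : ℤ) (ω : d.mixed.periodic.Z r) :
    J d r (d.mixed.periodicToProd d.mixed_β r (Submodule.Quotient.mk ω)) =
      (CochainCx.coneInl (I d)).map r (Submodule.Quotient.mk ω) :=
  congrArg ((CochainCx.coneInl (I d)).map r) ((d.mixed.periodicEquiv d.mixed_β r).symm_apply_apply _)

/-- Multiples of the unit die in `SH^r`: in the cone, they bound the same multiples of the unit of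
`⁺C^{r-2}(Λ[V ⊕ V̄])`. -/
theorem range_unit_le_ker_J {r : ℤ} (hr : 1 ≤ r) :
    LinearMap.range ((unitHom d).mapProdH r) ≤ LinearMap.ker (J d r) := by
  intro x hx
  obtain ⟨e, he, rfl⟩ := (mem_range_unit_iff d r x).1 hx
  rw [LinearMap.mem_ker]
  refine (J_periodicToProd d r _).trans ((Submodule.Quotient.mk_eq_zero _).2 ?_)
  refine ⟨(0, (unitLoop d).tot e), ⟨zero_mem _, ?_⟩, ?_⟩
  · change _ ∈ (Loop.mixed d).plus.deg (r - 1 + 1 + -2)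
    rw [show r - 1 + 1 + -2 = r - 2 by ring]
    exact (unitLoop d).plus.f_mem _ _ (point_mem_plus hr he)
  · refine Prod.ext ?_ ?_
    · change d.mixed.totD 0 + (Loop.projMixed d).tot ((unitLoop d).tot e) = (unitHom d).tot e
      rw [map_zero, zero_add, projMixed_tot_unitLoop]
    · change -(Loop.mixed d).totD ((unitLoop d).tot e) = 0
      rw [totD_unitLoop, neg_zero]

theorem ker_J_le_range_unit [CharZero κ] (r : ℤ) :
    LinearMap.ker (J d r) ≤ LinearMap.range ((unitHom d).mapProdH r) := by
  intro x hx
  obtain ⟨ω, hω, rfl⟩ := periodicToProd_surjective d r x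
  rw [LinearMap.mem_ker, J_periodicToProd] at hx
  obtain ⟨⟨x', y⟩, ⟨hx', hy⟩, hxy⟩ := (Submodule.Quotient.mk_eq_zero _).1 hx
  change ∀ n, d.mixed.C n at x'
  change ∀ n, (Loop.mixed d).C n at y
  change y ∈ (Loop.mixed d).plus.deg (r - 1 + 1 + -2) at hy
  rw [show r - 1 + 1 + -2 = r - 2 by ring] at hy
  have h1 : d.mixed.totD x' + (Loop.projMixed d).tot y = ω := congrArg Prod.fst hxy
  have h2 : -(Loop.mixed d).totD y = 0 := congrArg Prod.snd hxy
  obtain ⟨η, e, hη, he, hI⟩ := exists_I_eq_totD_add_unit d hy (neg_eq_zero.1 h2)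
  refine (mem_range_unit_iff d r _).2 ⟨e, he, congrArg _ ?_⟩
  symm
  refine (Submodule.Quotient.eq _).2 ?_
  refine ⟨x' + η, add_mem hx' hη, ?_⟩
  change d.mixed.totD (x' + η) = ω - (unitHom d).tot e
  rw [← h1, hI, map_add]; abel

theorem redB_J (r : ℤ) (x : K d r) : redB d r (J d r x) = 0 := by
  obtain ⟨ω, hω, rfl⟩ := periodicToProd_surjective d r x
  rw [J_periodicToProd]
  have h : B d r ((CochainCx.coneInl (I d)).map r (Submodule.Quotient.mk ⟨ω, hω⟩)) = 0 :=
    (Submodule.Quotient.mk_eq_zero _).2 (zero_mem ((Loop.mixed d).plus.B (r - 1)))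
  change Submodule.mkQ _ (B d r _) = 0
  rw [h, map_zero]

/-- If `B s` comes from `CH(κ)` then it vanishes, because `I B s = 0` and `I` does not kill the
nonzero multiples of the unit; hence `s` comes from `K`. -/
theorem exists_J_eq_of_redB_eq_zero (r : ℤ) (s : SH d r) (hs : redB d r s = 0) :
    ∃ x : K d r, J d r x = s := by
  obtain ⟨⟨⟨y, z⟩, ⟨hy, hz⟩, hD⟩, rfl⟩ := Submodule.Quotient.mk_surjective _ s
  change ∀ n, d.mixed.C n at y
  change ∀ n, (Loop.mixed d).C n at z
  have hD1 : d.mixed.totD y + (Loop.projMixed d).tot z = 0 := congrArg Prod.fst hD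
  obtain ⟨q, hq⟩ := (Submodule.Quotient.mk_eq_zero _).1 hs
  obtain ⟨⟨e, he⟩, rfl⟩ := Submodule.Quotient.mk_surjective _ q
  change ∀ n, (point κ).C n at e
  obtain ⟨w, hw, hwe⟩ := (Submodule.Quotient.eq _).1 hq
  change ∀ n, (Loop.mixed d).C n at w
  change (Loop.mixed d).totD w = (unitLoop d).tot e - z at hwe
  have hz' : z = (unitLoop d).tot e - (Loop.mixed d).totD w := by rw [hwe]; abel
  have hIw := (Loop.projMixed d).tot_comm w
  rw [hz', map_sub, projMixed_tot_unitLoop, hIw] at hD1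
  have he0 : e = 0 := by
    refine eq_zero_of_unit_eq_totD d (η := (Loop.projMixed d).tot w - y) ?_
    rw [map_sub, eq_sub_iff_add_eq, ← sub_eq_zero, ← hD1]; abel
  rw [he0, map_zero, zero_sub] at hz' hD1
  have hw' : w ∈ (Loop.mixed d).plus.deg (r + -2) := by
    rwa [show r + -2 = r - 1 - 1 by ring]
  have hyw : y - (Loop.projMixed d).tot w ∈ d.mixed.periodic.Z r := by
    refine ⟨sub_mem hy ((I d).f_mem r w hw'), ?_⟩
    change d.mixed.totD (y - (Loop.projMixed d).tot w) = 0
    rw [map_sub, ← hD1]; abel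
  refine ⟨_, (J_periodicToProd d r ⟨_, hyw⟩).trans ((Submodule.Quotient.eq _).2 ?_)⟩
  refine ⟨(0, -w), ⟨zero_mem _, neg_mem (S := Submodule κ (Loop.mixed d).plus.T) ?_⟩,
    Prod.ext ?_ ?_⟩
  · change w ∈ (Loop.mixed d).plus.deg (r - 1 + 1 + -2)
    rwa [show r - 1 + 1 + -2 = r + -2 by ring]
  · change d.mixed.totD 0 + (Loop.projMixed d).tot (-w) = (y - (Loop.projMixed d).tot w) - y
    rw [map_zero, map_neg]; abel
  · change -(Loop.mixed d).totD (-w) = 0 - z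
    rw [hz', map_neg]; abel

/-- A class of `CH^{r-1}` lifts to `SH^r` once `I` kills it, which can be achieved by subtracting a
multiple of the unit. -/
theorem redB_surjective [CharZero κ] {r : ℤ} (hr : 1 ≤ r) : Function.Surjective (redB d r) := by
  intro c
  obtain ⟨c, rfl⟩ := Submodule.Quotient.mk_surjective _ c
  obtain ⟨⟨z, hz, hDz⟩, rfl⟩ := Submodule.Quotient.mk_surjective _ c
  change ∀ n, (Loop.mixed d).C n at z
  replace hDz : (Loop.mixed d).totD z = 0 := hDz
  obtain ⟨η, e, hη, he, hI⟩ := exists_I_eq_totD_add_unit d (r := r + 1) (z := z)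
    (by rwa [show r + 1 - 2 = r - 1 by ring]) hDz
  rw [show r + 1 - 1 = r by ring] at hη
  have he' : e ∈ (point κ).plus.deg (r - 1) := by
    have := point_mem_plus (by linarith) he
    rwa [show r + 1 - 2 = r - 1 by ring] at this
  have hc : ((-η, z - (unitLoop d).tot e) :
      (∀ n, d.mixed.C n) × (∀ n, (Loop.mixed d).C n)) ∈ (CochainCx.cone (I d)).Z r := by
    refine ⟨⟨neg_mem (S := Submodule κ d.mixed.periodic.T) hη, ?_⟩, Prod.ext ?_ ?_⟩
    · change _ ∈ (Loop.mixed d).plus.deg (r + 1 + -2)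
      rw [show r + 1 + -2 = r - 1 by ring]
      exact sub_mem hz ((unitLoop d).plus.f_mem _ _ he')
    · change d.mixed.totD (-η) + (Loop.projMixed d).tot (z - (unitLoop d).tot e) = 0
      rw [map_neg, map_sub, projMixed_tot_unitLoop, hI]; abel
    · change -(Loop.mixed d).totD (z - (unitLoop d).tot e) = 0
      rw [map_sub, hDz, totD_unitLoop, sub_zero, neg_zero]
  refine ⟨Submodule.Quotient.mk ⟨_, hc⟩, (Submodule.Quotient.eq _).2 ?_⟩
  refine ⟨Submodule.Quotient.mk ⟨-e, neg_mem (S := Submodule κ (point κ).plus.T) he',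
    point_totD (-e)⟩, (Submodule.Quotient.eq _).2 ?_⟩
  refine ⟨0, zero_mem _, ?_⟩
  change (Loop.mixed d).totD 0 = (unitLoop d).tot (-e) - ((z - (unitLoop d).tot e) - z)
  rw [map_zero, map_neg]; abel

end Functors

end CyclicCDGA

theorem mainTheorem7 {κ : Type*} [Field κ] [CharZero κ]
    {A : Type*} [Ring A] [Algebra κ A] (𝒜 : ℕ → Submodule κ A) [GradedAlgebra 𝒜]
    (hcomm : CyclicCDGA.GradedCommutative 𝒜)
    (dA : CyclicCDGA.ExteriorDifferential 𝒜)
    (hA : CyclicCDGA.HomologicallyOneConnected dA)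
    {V : ℕ → Type*} [∀ n, AddCommGroup (V n)] [∀ n, Module κ (V n)] [Subsingleton (V 0)]
    (d : CyclicCDGA.ExteriorDifferential (CyclicCDGA.FreeCGA.grading κ V))
    (θ : CyclicCDGA.CDGAHom d dA) (hθ : θ.IsQuasiIso)
    (r : ℤ) (hr : 1 ≤ r) :
    ∃ redJ : CyclicCDGA.redK d r →ₗ[κ] CyclicCDGA.SH d r,
      (∀ x : CyclicCDGA.K d r, redJ (Submodule.Quotient.mk x) = CyclicCDGA.J d r x) ∧
      Function.Injective redJ ∧
      Function.Exact redJ (CyclicCDGA.redB d r) ∧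
      Function.Surjective (CyclicCDGA.redB d r) := by
  refine ⟨Submodule.liftQ _ (CyclicCDGA.J d r) (CyclicCDGA.range_unit_le_ker_J d hr),
    fun _ => rfl, ?_, fun s => ⟨fun hs => ?_, ?_⟩, CyclicCDGA.redB_surjective d hr⟩
  · rw [← LinearMap.ker_eq_bot]
    exact Submodule.ker_liftQ_eq_bot _ _ _ (CyclicCDGA.ker_J_le_range_unit d r)
  · obtain ⟨x, rfl⟩ := CyclicCDGA.exists_J_eq_of_redB_eq_zero d r s hs
    exact ⟨Submodule.Quotient.mk x, rfl⟩
  · rintro ⟨q, rfl⟩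
    obtain ⟨x, rfl⟩ := Submodule.Quotient.mk_surjective _ q
    exact CyclicCDGA.redB_J d r x
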